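/- \textbf{Conventions.} A map is \emph{short} if it is $1$-Lipschitz. Let $\mathsf{L\text{-}COMet}$ be the category whose objects are the complete metric spaces $X$ with a partial order whose graph is closed in $X\times X$ and which is \emph{L-ordered}: $x\le y$ if and only if $f(x)\le f(y)$ for every short monotone $f:X\to\mathbb R$. Its morphisms are the short monotone maps. For $X$ in $\mathsf{L\text{-}COMet}$ let $PX$ be the set of Radon probability measures $p$ on $X$ of finite first moment (every short $f:X\to\mathbb R$ is $p$-integrable), with the Kantorovich--Wasserstein metric $d(p,q)=\sup_f\left(\int f\,dq-\int f\,dp\right)$, where $f$ ranges over the short functions $X\to\mathbb R$, and with the stochastic order: $p\le q$ if and only if there is a Radon measure on $X\times X$ with marginals $p$ and $q$ which is supported on $\{(x,y)\mid x\le y\}$. For a morphism $f:X\to Y$ let $Pf:PX\to PY$ be the pushforward of measures; let $\delta:X\to PX$ be $x\mapsto\delta_x$, and let $E:PPX\to PX$ be $(E\mu)(S)=\int_{PX} p(S)\,d\mu(p)$ for Borel sets $S\subseteq X$. An \emph{ordered Banach space} is a real Banach space $B$ with a closed convex cone $B^+$ containing $0$ (not required to satisfy $B^+\cap(-B^+)=0$),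 and $x\le y$ means $y-x\in B^+$. Let $\mathsf{CC}$ be the category whose objects are the closed convex subsets $A$ of ordered Banach spaces on which the induced relation $\le$ is antisymmetric, hence a partial order, and whose morphisms are the short, affine, monotone maps between such subsets. (Empty spaces and empty subsets are allowed.) \textbf{Theorem.} $(P,\delta,E)$ is a monad on $\mathsf{L\text{-}COMet}$, the \emph{ordered Kantorovich monad}. Every object $A$ of $\mathsf{CC}$, with the metric and order induced from its Banach space, is an object of $\mathsf{L\text{-}COMet}$, and the category of $P$-algebras (the Eilenberg--Moore category of $P$) is equivalent to $\mathsf{CC}$. The equivalence can be chosen compatible, up to natural isomorphism, with the forgetful functors to $\mathsf{L\text{-}COMet}$, and such that it sends $A$ to $A$ with the algebra structure given by integration, $PA\to A$, $p\mapsto\int_A a\,dp(a)$. -/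

import Mathlib

open CategoryTheory MeasureTheory

universe u

/-- An ordered metric space is L-ordered if its order is detected by the short (1-Lipschitz)
monotone real functions. -/
def IsLOrdered (X : Type u) [MetricSpace X] [PartialOrder X] : Prop :=
  ∀ x y : X, x ≤ y ↔ ∀ f : X → ℝ, LipschitzWith 1 f → Monotone f → f x ≤ f y

/-- Complete L-ordered metric spaces: complete metric spaces with a partial order whose graph is
closed and which is L-ordered. -/
structure LCOMet : Type (u + 1) where
  carrier : Type u
  [metricSpace : MetricSpace carrier]
  [partialOrder : PartialOrder carrier]
  [completeSpace : CompleteSpace carrier]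
  isClosed_le : IsClosed {z : carrier × carrier | z.1 ≤ z.2}
  isLOrdered : IsLOrdered carrier

namespace LCOMet

attribute [instance] metricSpace partialOrder completeSpace

/-- Every space carries its Borel sigma-algebra. -/
instance (X : LCOMet.{u}) : MeasurableSpace X.carrier := borel X.carrier

instance (X : LCOMet.{u}) : BorelSpace X.carrier := ⟨rfl⟩

/-- Morphisms: short monotone maps. -/
@[ext]
structure Hom (X Y : LCOMet.{u}) : Type u where
  toFun : X.carrier → Y.carrier
  short : LipschitzWith 1 toFun
  monotone : Monotone toFun

instance : Category LCOMet.{u} where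
  Hom := Hom
  id X := ⟨fun x => x, LipschitzWith.id, monotone_id⟩
  comp f g := ⟨fun x => g.toFun (f.toFun x),
    (by simpa [Function.comp_def] using g.short.comp f.short), g.monotone.comp f.monotone⟩

/-- The set `PX` of Radon probability measures of finite first moment on `X`: Borel probability
measures, inner regular with respect to compact sets, for which all short real functions are
integrable. -/
def RadonProb (X : LCOMet.{u}) : Type u :=
  {p : Measure X.carrier // IsProbabilityMeasure p ∧ p.InnerRegular ∧
    ∀ f : X.carrier → ℝ, LipschitzWith 1 f → Integrable f p}

/-- The underlying Borel measure. -/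
def RadonProb.measure {X : LCOMet.{u}} (p : RadonProb X) : Measure X.carrier := p.1

/-- `d` is the Kantorovich-Wasserstein distance of `p` and `q`: it is the supremum of
`∫ f dq - ∫ f dp` over all short functions `f`. -/
def IsWassersteinDist {X : LCOMet.{u}} (p q : RadonProb X) (d : ℝ) : Prop :=
  IsLUB {r : ℝ | ∃ f : X.carrier → ℝ, LipschitzWith 1 f ∧
    r = (∫ x, f x ∂q.measure) - ∫ x, f x ∂p.measure} d

/-- The stochastic order: there is a coupling of `p` and `q`, i.e. a Radon measure on the Borel
sets of `X × X` with marginals `p` and `q`, which is supported on the graph of the order. -/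
def StochLE {X : LCOMet.{u}} (p q : RadonProb X) : Prop :=
  letI : MeasurableSpace (X.carrier × X.carrier) := borel (X.carrier × X.carrier)
  ∃ r : Measure (X.carrier × X.carrier), r.InnerRegular ∧
    r.map Prod.fst = p.measure ∧ r.map Prod.snd = q.measure ∧
    r {z | ¬ z.1 ≤ z.2} = 0

end LCOMet

/-- The ordered Kantorovich monad `(P, δ, E)` on complete L-ordered metric spaces.
The underlying set of the space `P X` is (via the bijection `law`) the set of Radon probability
measures of finite first moment, its metric is the Kantorovich-Wasserstein metric, its order is the
stochastic order, `P f` is the pushforward of measures along `f`, the unit `δ` sends a point to its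
Dirac measure, and the multiplication `E` sends `m` to the measure `S ↦ ∫ p(S) dm(p)`.
All of the data is thus determined up to the bijections `law`. -/
structure OrderedKantorovichMonad : Type (u + 1) where
  monad : Monad LCOMet.{u}
  law (X : LCOMet.{u}) : (monad.obj X).carrier ≃ LCOMet.RadonProb X
  dist_law (X : LCOMet.{u}) (p q : (monad.obj X).carrier) :
    LCOMet.IsWassersteinDist (law X p) (law X q) (dist p q)
  le_iff (X : LCOMet.{u}) (p q : (monad.obj X).carrier) :
    p ≤ q ↔ LCOMet.StochLE (law X p) (law X q)
  law_map {X Y : LCOMet.{u}} (f : X ⟶ Y) (p : (monad.obj X).carrier) :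
    (law Y ((monad.map f).toFun p)).measure = (law X p).measure.map f.toFun
  law_unit (X : LCOMet.{u}) (x : X.carrier) :
    (law X ((monad.η.app X).toFun x)).measure = Measure.dirac x
  law_mul (X : LCOMet.{u}) (m : (monad.obj (monad.obj X)).carrier) (S : Set X.carrier)
    (hS : MeasurableSet S) :
    (law X ((monad.μ.app X).toFun m)).measure S =
      ∫⁻ p, (law X p).measure S ∂(law (monad.obj X) m).measure

/-- A closed convex subset `A` of an ordered Banach space, that is, of a real Banach space `B`
with a closed convex cone, `x ≤ y` meaning that `y - x` lies in the cone. As the cone may contain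
a line, antisymmetry of the order is required on the subset `A`. -/
structure ClosedConvexSubset : Type (u + 1) where
  B : Type u
  [normedAddCommGroup : NormedAddCommGroup B]
  [normedSpace : NormedSpace ℝ B]
  [completeSpace : CompleteSpace B]
  cone : ProperCone ℝ B
  A : Set B
  isClosed : IsClosed A
  convex : Convex ℝ A
  antisymm : ∀ x ∈ A, ∀ y ∈ A, y - x ∈ cone → x - y ∈ cone → x = y

namespace ClosedConvexSubset

attribute [instance] normedAddCommGroup normedSpace completeSpace

/-- The order on `A` induced by the positive cone. -/
instance (K : ClosedConvexSubset.{u}) : PartialOrder K.A where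
  le x y := (y : K.B) - x ∈ K.cone
  le_refl x := by
    rw [sub_self]
    exact zero_mem _
  le_trans x y z hxy hyz := by
    have h := add_mem hyz hxy
    rwa [sub_add_sub_cancel] at h
  le_antisymm x y hxy hyx := Subtype.ext (K.antisymm x x.2 y y.2 hxy hyx)

/-- Morphisms: short affine monotone maps. -/
@[ext]
structure Hom (K L : ClosedConvexSubset.{u}) : Type u where
  toFun : K.A → L.A
  short : LipschitzWith 1 toFun
  monotone : Monotone toFun
  affine : ∀ (x y : K.A) (a b : ℝ) (ha : 0 ≤ a) (hb : 0 ≤ b) (hab : a + b = 1),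
    (toFun ⟨a • (x : K.B) + b • (y : K.B), K.convex x.2 y.2 ha hb hab⟩ : L.B) =
      a • (toFun x : L.B) + b • (toFun y : L.B)

instance : Category ClosedConvexSubset.{u} where
  Hom := Hom
  id K := ⟨fun x => x, LipschitzWith.id, monotone_id, fun _ _ _ _ _ _ _ => rfl⟩
  comp f g := ⟨fun x => g.toFun (f.toFun x),
    (by simpa [Function.comp_def] using g.short.comp f.short), g.monotone.comp f.monotone, by
      intro x y a b ha hb hab
      rw [← g.affine _ _ a b ha hb hab]
      congr 2
      exact Subtype.ext (f.affine x y a b ha hb hab)⟩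

theorem isClosed_le (K : ClosedConvexSubset.{u}) : IsClosed {z : K.A × K.A | z.1 ≤ z.2} := by
  have h : Continuous fun z : K.A × K.A => (z.2 : K.B) - z.1 := by fun_prop
  exact K.cone.isClosed.preimage h

/-- By Hahn-Banach separation, the order on `A` is detected by short monotone functions. -/
theorem isLOrdered (K : ClosedConvexSubset.{u}) : IsLOrdered K.A := by
  intro x y
  refine ⟨fun h f _ hf => hf h, fun h => ?_⟩
  by_contra hn
  obtain ⟨g, hg0, hg⟩ := ProperCone.hyperplane_separation_point K.cone (x₀ := (y : K.B) - x) hn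
  have hpos : 0 < (1 + ‖g‖) := by positivity
  have := h (fun z => (1 + ‖g‖)⁻¹ * g z) ?_ ?_
  · have h2 := le_of_mul_le_mul_left this (by positivity)
    simp only [map_sub] at hg
    linarith
  · refine LipschitzWith.of_dist_le_mul fun a b => ?_
    rw [Real.dist_eq, ← mul_sub, ← map_sub, abs_mul, abs_of_nonneg (by positivity),
      NNReal.coe_one, one_mul, Subtype.dist_eq, dist_eq_norm, inv_mul_le_iff₀ hpos]
    have := g.le_opNorm ((a : K.B) - b)
    rw [Real.norm_eq_abs] at this
    nlinarith [norm_nonneg ((a : K.B) - b)]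
  · intro a b hab
    have := hg0 _ hab
    rw [map_sub] at this
    have h3 : g a ≤ g b := by linarith
    exact mul_le_mul_of_nonneg_left h3 (by positivity)

/-- The underlying complete L-ordered metric space of `A`. -/
def toLCOMet : ClosedConvexSubset.{u} ⥤ LCOMet.{u} where
  obj K :=
    { carrier := K.A
      completeSpace := K.isClosed.completeSpace_coe
      isClosed_le := K.isClosed_le
      isLOrdered := K.isLOrdered }
  map f := ⟨f.toFun, f.short, f.monotone⟩

/-- The inclusion of `A` into the Banach space. -/
def incl (K : ClosedConvexSubset.{u}) (x : (toLCOMet.obj K).carrier) : K.B := Subtype.val x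

end ClosedConvexSubset

/-!
The monad. Everything about `PX` reduces to integrals of short functions. Truncations of short
functions are short, so the Wasserstein distance can be tested on bounded short functions, and a
totally bounded set of measures is uniformly tight (`exists_compact_of_totallyBounded`). With
Prokhorov's theorem this makes `PX` complete, and it makes averages of measures in `PPX` tight,
hence Radon (`join`). The stochastic order is controlled by monotone Kantorovich duality
(`exists_coupling_of_forall_integral_le`): `p ≤ q` as soon as `∫ f dp ≤ ∫ f dq` for all short
monotone `f`. For finitely supported measures one separates convex sets in finite dimension
(`exists_transportPlan`), for the cost `c x y = sup (f x - f y)`, which vanishes exactly when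
`x ≤ y`; in general one passes to a weak limit of couplings of finitely supported approximations.
Closedness of the order, L-orderedness and monotonicity of all structure maps follow at once, while
antisymmetry holds because a coupling that preserves the integrals of all short monotone functions
must live on the diagonal (`eq_of_forall_integral_eq`). The monad laws are identities of iterated
integrals.

The algebras. A closed convex set is an algebra by Bochner integration. A short affine map `f`
commutes with integration because its graph is closed and convex and therefore contains barycentres
(`map_bary`); conversely an algebra morphism preserves barycentres of two-point measures. This gives
a fully faithful functor over the complete L-ordered metric spaces.

Essential surjectivity. An algebra `a : PX → X` embeds into the bounded functions on the set of its
short affine functions, those `f` with `f (a p) = ∫ f dp`, with the cone of functions that are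
nonnegative on the monotone ones. It must be shown that affine functions detect both the distance
and the order. By Hahn–Banach (`IsMixing.exists_affine`) this amounts to the following estimate
(`HasBound.sub_le`), applied to the relations `=` and `≤`: if `a p` and `a q` are related and
`δ x - δ y + c (q - p)` has norm at most `D`, then `g x - g y ≤ D` for every short `g` that is
monotone for the relation. To see this, move from `x` to `y` in `n` steps of the form
`(c p + (n - k) δ x + k δ y) / (n + c)`. Exchanging `p` for `q` moves the image under `a` in the
direction of the relation, and after this exchange the next step is at distance at most
`D / (n + c)`. The `n` steps add up to at most `D`, and the endpoints converge to `x` and `y` as `n`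
grows.
-/

section KantorovichSpaces

open Filter Topology

/-! ### Short functions and tight measures -/

theorem LipschitzWith.short_inv_mul {Z : Type*} [PseudoMetricSpace Z] {f : Z → ℝ} {C : NNReal}
    (hf : LipschitzWith C f) : LipschitzWith 1 fun z => ((C : ℝ) + 1)⁻¹ * f z := by
  have hC : (0 : ℝ) < C + 1 := by positivity
  refine LipschitzWith.of_dist_le_mul fun x y => ?_
  rw [Real.dist_eq, ← mul_sub, abs_mul, abs_of_pos (inv_pos.2 hC), NNReal.coe_one, one_mul,
    inv_mul_le_iff₀ hC]
  have := hf.dist_le_mul x y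
  rw [Real.dist_eq] at this
  nlinarith [dist_nonneg (x := x) (y := y)]

/-- A finite Borel measure on a metric space which is tight is inner regular with respect to
compact sets: closed sets approximate from inside, and they may be cut by a large compact set. -/
theorem MeasureTheory.Measure.innerRegular_of_tight {Z : Type*} [MetricSpace Z] [MeasurableSpace Z]
    [BorelSpace Z] (μ : Measure Z) [IsFiniteMeasure μ]
    (h : ∀ ε : ENNReal, ε ≠ 0 → ∃ K, IsCompact K ∧ μ Kᶜ ≤ ε) : μ.InnerRegular := by
  refine ⟨fun s hs r hr => ?_⟩
  obtain ⟨δ, hδ, hrδ⟩ : ∃ δ : ENNReal, 0 < δ ∧ r + δ < μ s :=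
    ENNReal.lt_iff_exists_add_pos_lt.1 hr |>.elim fun a ha => ⟨a, by simpa using ha.1, ha.2⟩
  have hδ2 : δ / 2 ≠ 0 := by simpa using hδ.ne'
  obtain ⟨F, hFs, hF, hlt⟩ := hs.exists_isClosed_lt_add (measure_ne_top μ s) hδ2
  obtain ⟨K, hK, hKε⟩ := h (δ / 2) hδ2
  refine ⟨F ∩ K, Set.inter_subset_left.trans hFs, hK.inter_left hF, ?_⟩
  have h1 : μ F ≤ μ (F ∩ K) + δ / 2 := by
    calc μ F ≤ μ (F ∩ K) + μ (F \ K) := measure_le_inter_add_sdiff μ F K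
      _ ≤ μ (F ∩ K) + δ / 2 := by
        gcongr
        exact (measure_mono fun x hx => hx.2).trans hKε
  have h2 : r + δ < μ (F ∩ K) + δ := by
    calc r + δ < μ s := hrδ
      _ < μ F + δ / 2 := hlt
      _ ≤ μ (F ∩ K) + δ / 2 + δ / 2 := by gcongr
      _ = μ (F ∩ K) + δ := by rw [add_assoc, ENNReal.add_halves]
  exact lt_of_add_lt_add_right h2

/-- Two finite Borel measures on a metric space that integrate all bounded short functions
equally are equal. -/
theorem MeasureTheory.Measure.ext_of_forall_short {Z : Type*} [MetricSpace Z] [MeasurableSpace Z]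
    [BorelSpace Z] {μ ν : Measure Z} [IsFiniteMeasure μ] [IsFiniteMeasure ν]
    (h : ∀ f : Z → ℝ, LipschitzWith 1 f → (∃ M, ∀ x, |f x| ≤ M) → ∫ x, f x ∂μ = ∫ x, f x ∂ν) :
    μ = ν := by
  have key : ∀ F : Set Z, IsClosed F → μ F = ν F := by
    intro F hF
    have hpos : ∀ n : ℕ, 0 < 1 / ((n : ℝ) + 1) := fun n => by positivity
    have hlim := tendsto_one_div_add_atTop_nhds_zero_nat (𝕜 := ℝ)
    have h1 := tendsto_lintegral_thickenedIndicator_of_isClosed μ hF hpos hlim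
    have h2 := tendsto_lintegral_thickenedIndicator_of_isClosed ν hF hpos hlim
    refine tendsto_nhds_unique h1 (h2.congr fun n => ?_)
    set g : Z → ℝ := fun x => (thickenedIndicator (hpos n) F x : ℝ) with hg
    have hle : ∀ x, g x ≤ 1 := fun x => by
      have := thickenedIndicator_le_one (hpos n) F x
      exact NNReal.coe_le_one.2 this
    have hnn : ∀ x, 0 ≤ g x := fun x => NNReal.coe_nonneg _
    have hcont : Continuous g :=
      NNReal.continuous_coe.comp (thickenedIndicator (hpos n) F).continuous
    have hint : ∀ ρ : Measure Z, IsFiniteMeasure ρ → Integrable g ρ := fun ρ _ =>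
      Integrable.of_bound hcont.aestronglyMeasurable 1
        (Eventually.of_forall fun x => by rw [Real.norm_of_nonneg (hnn x)]; exact hle x)
    have hl : ∀ ρ : Measure Z, IsFiniteMeasure ρ →
        ∫⁻ x, (thickenedIndicator (hpos n) F x : ENNReal) ∂ρ = ENNReal.ofReal (∫ x, g x ∂ρ) := by
      intro ρ hρ
      rw [ofReal_integral_eq_lintegral_ofReal (hint ρ hρ) (Eventually.of_forall hnn)]
      simp [hg]
    rw [hl μ inferInstance, hl ν inferInstance]
    have h3 := h (fun x => 1 / ((n : ℝ) + 1) * g x) ?_ ⟨1 / ((n : ℝ) + 1), fun x => ?_⟩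
    · rw [integral_const_mul, integral_const_mul] at h3
      rw [mul_left_cancel₀ (hpos n).ne' h3]
    · refine LipschitzWith.of_dist_le_mul fun x y => ?_
      have := (lipschitzWith_thickenedIndicator (hpos n) F).dist_le_mul x y
      rw [NNReal.dist_eq] at this
      rw [Real.dist_eq, ← mul_sub, abs_mul, abs_of_pos (hpos n)]
      calc 1 / ((n : ℝ) + 1) * |g x - g y|
          ≤ 1 / ((n : ℝ) + 1) * ((((1 / ((n : ℝ) + 1)).toNNReal⁻¹ : NNReal) : ℝ) * dist x y) :=
            mul_le_mul_of_nonneg_left this (hpos n).le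
        _ = ((1 : NNReal) : ℝ) * dist x y := by
            rw [NNReal.coe_inv, Real.coe_toNNReal _ (hpos n).le, ← mul_assoc,
              mul_inv_cancel₀ (hpos n).ne', NNReal.coe_one]
    · rw [abs_of_nonneg (mul_nonneg (hpos n).le (hnn x))]
      exact mul_le_of_le_one_right (hpos n).le (hle x)
  exact ext_of_generate_finite _
    ((BorelSpace.measurable_eq (α := Z)).trans borel_eq_generateFrom_isClosed)
    isPiSystem_isClosed key (key _ isClosed_univ)

/-! ### Measures of finite first moment -/

/-- The set of Radon probability measures of finite first moment on a metric space. -/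
def KantorovichSpace (X : Type u) [MetricSpace X] [MeasurableSpace X] : Type u :=
  {p : Measure X // IsProbabilityMeasure p ∧ p.InnerRegular ∧
    ∀ f : X → ℝ, LipschitzWith 1 f → Integrable f p}

namespace KantorovichSpace

/-- The truncation of a real function at height `M`. -/
def trunc {X : Type*} (M : ℝ) (f : X → ℝ) (x : X) : ℝ := max (-M) (min M (f x))

theorem short_trunc {X : Type*} [MetricSpace X] (M : ℝ) {f : X → ℝ} (hf : LipschitzWith 1 f) :
    LipschitzWith 1 (trunc M f) :=
  (hf.const_min M).const_max (-M)

theorem abs_trunc_le {X : Type*} {M : ℝ} (hM : 0 ≤ M) (f : X → ℝ) (x : X) : |trunc M f x| ≤ M :=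
  abs_le.2 ⟨le_max_left _ _, max_le (by linarith) (min_le_left _ _)⟩

theorem abs_trunc_le_abs {X : Type*} {M : ℝ} (hM : 0 ≤ M) (f : X → ℝ) (x : X) :
    |trunc M f x| ≤ |f x| := by
  unfold trunc
  rcases le_total (f x) M with h | h
  · rw [min_eq_right h]
    rcases le_total (f x) (-M) with h' | h'
    · rw [max_eq_left h', abs_neg, abs_of_nonneg hM, abs_of_nonpos (by linarith)]; linarith
    · rw [max_eq_right h']
  · rw [min_eq_left h, max_eq_right (by linarith), abs_of_nonneg hM]
    exact h.trans (le_abs_self _)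

theorem trunc_of_abs_le {X : Type*} {M : ℝ} {f : X → ℝ} {x : X} (h : |f x| ≤ M) :
    trunc M f x = f x := by
  have := abs_le.1 h
  rw [trunc, min_eq_right this.2, max_eq_right this.1]

variable {X : Type u} [MetricSpace X] [MeasurableSpace X]

/-- The underlying Borel measure. -/
def measure (p : KantorovichSpace X) : Measure X := p.1

instance (p : KantorovichSpace X) : IsProbabilityMeasure p.measure := p.2.1

instance (p : KantorovichSpace X) : p.measure.InnerRegular := p.2.2.1

theorem integrable_of_short (p : KantorovichSpace X) {f : X → ℝ} (hf : LipschitzWith 1 f) :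
    Integrable f p.measure := p.2.2.2 f hf

theorem integrable_of_lipschitz (p : KantorovichSpace X) {f : X → ℝ} {C : NNReal}
    (hf : LipschitzWith C f) : Integrable f p.measure := by
  have hC : (0 : ℝ) < C + 1 := by positivity
  have h := p.integrable_of_short hf.short_inv_mul
  refine (h.const_mul ((C : ℝ) + 1)).congr (Eventually.of_forall fun x => ?_)
  simp only
  rw [mul_inv_cancel_left₀ hC.ne']

theorem integrable_dist (p : KantorovichSpace X) (x₀ : X) :
    Integrable (fun x => dist x x₀) p.measure :=
  p.integrable_of_short (LipschitzWith.dist_left x₀)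

theorem nonempty (p : KantorovichSpace X) : Nonempty X :=
  nonempty_of_isProbabilityMeasure p.measure

theorem exists_compact [BorelSpace X] (p : KantorovichSpace X) {ε : ENNReal} (hε : ε ≠ 0) :
    ∃ K, IsCompact K ∧ p.measure Kᶜ ≤ ε := by
  have := isTightMeasureSet_iff_exists_isCompact_measure_compl_le.1
    (isTightMeasureSet_singleton_of_innerRegular (μ := p.measure)) ε (pos_iff_ne_zero.2 hε)
  simpa using this

theorem ext_measure {p q : KantorovichSpace X} (h : p.measure = q.measure) : p = q := Subtype.ext h

theorem ext_short [BorelSpace X] {p q : KantorovichSpace X}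
    (h : ∀ f : X → ℝ, LipschitzWith 1 f → ∫ x, f x ∂p.measure = ∫ x, f x ∂q.measure) : p = q :=
  ext_measure (Measure.ext_of_forall_short fun f hf _ => h f hf)

/-- A tight Borel probability measure with finite first moment at one point. -/
def ofTight [BorelSpace X] (μ : Measure X) [IsProbabilityMeasure μ]
    (h : ∀ ε : ENNReal, ε ≠ 0 → ∃ K, IsCompact K ∧ μ Kᶜ ≤ ε)
    (hint : ∀ x₀, Integrable (fun x => dist x x₀) μ) : KantorovichSpace X :=
  ⟨μ, inferInstance, μ.innerRegular_of_tight h, fun f hf => by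
    obtain ⟨x₀⟩ := nonempty_of_isProbabilityMeasure μ
    have h2 : Integrable (fun x => f x - f x₀) μ := by
      refine (hint x₀).mono' (hf.continuous.sub continuous_const).aestronglyMeasurable
        (Eventually.of_forall fun x => ?_)
      have := hf.dist_le_mul x x₀
      rwa [NNReal.coe_one, one_mul, Real.dist_eq] at this
    exact (h2.add (integrable_const (f x₀))).congr (Eventually.of_forall fun x => by simp)⟩

/-! ### The Kantorovich–Wasserstein metric -/

theorem integral_sub_le_add (p q : KantorovichSpace X) (x₀ : X) {f : X → ℝ}
    (hf : LipschitzWith 1 f) :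
    (∫ x, f x ∂q.measure) - ∫ x, f x ∂p.measure ≤
      (∫ x, dist x x₀ ∂q.measure) + ∫ x, dist x x₀ ∂p.measure := by
  have hd : ∀ x, |f x - f x₀| ≤ dist x x₀ := fun x => by
    have := hf.dist_le_mul x x₀
    rwa [NNReal.coe_one, one_mul, Real.dist_eq] at this
  have h1 : ∫ x, f x ∂q.measure ≤ ∫ x, (f x₀ + dist x x₀) ∂q.measure :=
    integral_mono (q.integrable_of_short hf) ((integrable_const _).add (q.integrable_dist x₀))
      fun x => by have := (abs_le.1 (hd x)).2; simp only; linarith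
  have h2 : ∫ x, (f x₀ - dist x x₀) ∂p.measure ≤ ∫ x, f x ∂p.measure :=
    integral_mono ((integrable_const _).sub (p.integrable_dist x₀)) (p.integrable_of_short hf)
      fun x => by have := (abs_le.1 (hd x)).1; simp only; linarith
  rw [integral_add (integrable_const _) (q.integrable_dist x₀)] at h1
  rw [integral_sub (integrable_const _) (p.integrable_dist x₀)] at h2
  simp only [integral_const, probReal_univ, one_smul] at h1 h2
  linarith

noncomputable instance : Dist (KantorovichSpace X) where
  dist p q := sSup {r : ℝ | ∃ f : X → ℝ, LipschitzWith 1 f ∧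
    r = (∫ x, f x ∂q.measure) - ∫ x, f x ∂p.measure}

theorem isLUB_dist (p q : KantorovichSpace X) :
    IsLUB {r : ℝ | ∃ f : X → ℝ, LipschitzWith 1 f ∧
      r = (∫ x, f x ∂q.measure) - ∫ x, f x ∂p.measure} (dist p q) := by
  refine isLUB_csSup ⟨0, fun _ => 0, LipschitzWith.const 0 |>.weaken zero_le_one, by simp⟩ ?_
  obtain ⟨x₀⟩ := p.nonempty
  refine ⟨(∫ x, dist x x₀ ∂q.measure) + ∫ x, dist x x₀ ∂p.measure, ?_⟩
  rintro r ⟨f, hf, rfl⟩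
  exact integral_sub_le_add p q x₀ hf

theorem integral_sub_le_dist (p q : KantorovichSpace X) {f : X → ℝ} (hf : LipschitzWith 1 f) :
    (∫ x, f x ∂q.measure) - ∫ x, f x ∂p.measure ≤ dist p q :=
  (isLUB_dist p q).1 ⟨f, hf, rfl⟩

theorem dist_le_of_forall {p q : KantorovichSpace X} {C : ℝ}
    (h : ∀ f : X → ℝ, LipschitzWith 1 f →
      (∫ x, f x ∂q.measure) - ∫ x, f x ∂p.measure ≤ C) : dist p q ≤ C :=
  (isLUB_dist p q).2 (by rintro r ⟨f, hf, rfl⟩; exact h f hf)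

theorem integral_sub_le_dist_symm (p q : KantorovichSpace X) {f : X → ℝ} (hf : LipschitzWith 1 f) :
    (∫ x, f x ∂p.measure) - ∫ x, f x ∂q.measure ≤ dist p q := by
  have := integral_sub_le_dist p q (f := fun x => -f x) hf.neg
  rw [integral_neg, integral_neg] at this
  linarith

noncomputable instance [BorelSpace X] : MetricSpace (KantorovichSpace X) where
  dist_self p := le_antisymm (dist_le_of_forall fun f _ => (sub_self _).le)
    (by simpa using integral_sub_le_dist p p ((LipschitzWith.const (0 : ℝ)).weaken zero_le_one))
  dist_comm p q := le_antisymm (dist_le_of_forall fun f hf => integral_sub_le_dist_symm q p hf)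
    (dist_le_of_forall fun f hf => integral_sub_le_dist_symm p q hf)
  dist_triangle p q r := dist_le_of_forall fun f hf => by
    have h1 := integral_sub_le_dist p q hf
    have h2 := integral_sub_le_dist q r hf
    linarith
  eq_of_dist_eq_zero {p q} h := ext_short fun f hf => by
    have h1 := integral_sub_le_dist p q hf
    have h2 := integral_sub_le_dist_symm p q hf
    linarith

noncomputable instance [BorelSpace X] : MeasurableSpace (KantorovichSpace X) := borel _

instance [BorelSpace X] : BorelSpace (KantorovichSpace X) := ⟨rfl⟩

theorem short_integral [BorelSpace X] {f : X → ℝ} (hf : LipschitzWith 1 f) :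
    LipschitzWith 1 fun p : KantorovichSpace X => ∫ x, f x ∂p.measure :=
  LipschitzWith.of_dist_le_mul fun p q => by
    rw [NNReal.coe_one, one_mul, Real.dist_eq, abs_le]
    have h1 := integral_sub_le_dist p q hf
    have h2 := integral_sub_le_dist_symm p q hf
    constructor <;> linarith

theorem tendsto_integral_trunc [BorelSpace X] (μ : Measure X) {f : X → ℝ}
    (hf : LipschitzWith 1 f) (hint : Integrable f μ) :
    Tendsto (fun n : ℕ => ∫ x, trunc n f x ∂μ) atTop (𝓝 (∫ x, f x ∂μ)) := by
  refine tendsto_integral_of_dominated_convergence (fun x => |f x|)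
    (fun n => (short_trunc _ hf).continuous.aestronglyMeasurable) hint.abs
    (fun n => Eventually.of_forall fun x => abs_trunc_le_abs (Nat.cast_nonneg n) f x)
    (Eventually.of_forall fun x => ?_)
  obtain ⟨N, hN⟩ := exists_nat_ge |f x|
  refine tendsto_const_nhds.congr' ?_
  filter_upwards [eventually_ge_atTop N] with n hn
  exact (trunc_of_abs_le (hN.trans (by exact_mod_cast hn))).symm

/-- The Wasserstein distance may be tested on bounded short functions, since truncations of short
functions are short. -/
theorem dist_le_of_forall_bounded [BorelSpace X] {p q : KantorovichSpace X} {C : ℝ}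
    (h : ∀ f : X → ℝ, LipschitzWith 1 f → (∃ M, ∀ x, |f x| ≤ M) →
      (∫ x, f x ∂q.measure) - ∫ x, f x ∂p.measure ≤ C) : dist p q ≤ C :=
  dist_le_of_forall fun f hf => le_of_tendsto'
    ((tendsto_integral_trunc q.measure hf (q.integrable_of_short hf)).sub
      (tendsto_integral_trunc p.measure hf (p.integrable_of_short hf)))
    fun n => h _ (short_trunc _ hf) ⟨n, abs_trunc_le (Nat.cast_nonneg n) f⟩

/-! ### Pushforwards, Dirac measures and convex combinations -/

section Constructions

variable [BorelSpace X]

/-- The pushforward of a measure along a short map. -/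
noncomputable def map {Y : Type u} [MetricSpace Y] [MeasurableSpace Y] [BorelSpace Y]
    (f : X → Y) (hf : LipschitzWith 1 f) (p : KantorovichSpace X) : KantorovichSpace Y :=
  ⟨p.measure.map f, Measure.isProbabilityMeasure_map hf.continuous.measurable.aemeasurable,
    Measure.InnerRegular.map_of_continuous hf.continuous, fun g hg =>
      (integrable_map_measure hg.continuous.aestronglyMeasurable
        hf.continuous.measurable.aemeasurable).2
        (p.integrable_of_short (by simpa using hg.comp hf))⟩

theorem integral_map {Y : Type u} [MetricSpace Y] [MeasurableSpace Y] [BorelSpace Y]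
    {f : X → Y} (hf : LipschitzWith 1 f) (p : KantorovichSpace X) {g : Y → ℝ} (hg : Continuous g) :
    ∫ y, g y ∂(map f hf p).measure = ∫ x, g (f x) ∂p.measure :=
  MeasureTheory.integral_map hf.continuous.measurable.aemeasurable hg.aestronglyMeasurable

/-- The Dirac measure. -/
noncomputable def dirac (x : X) : KantorovichSpace X :=
  ofTight (Measure.dirac x) (fun ε _ => ⟨{x}, isCompact_singleton, by simp⟩)
    fun x₀ => integrable_dirac (by simp)

theorem integral_dirac (x : X) (f : X → ℝ) : ∫ y, f y ∂(dirac x).measure = f x :=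
  MeasureTheory.integral_dirac f x

/-- The convex combination `t p + (1 - t) q`. -/
noncomputable def mix (t : unitInterval) (p q : KantorovichSpace X) : KantorovichSpace X :=
  have : IsProbabilityMeasure
      (ENNReal.ofReal t • p.measure + ENNReal.ofReal (1 - t) • q.measure) := ⟨by
    simp only [Measure.add_apply, Measure.smul_apply, measure_univ, smul_eq_mul, mul_one]
    rw [← ENNReal.ofReal_add t.2.1 (sub_nonneg.2 t.2.2)]
    simp⟩
  ofTight (ENNReal.ofReal t • p.measure + ENNReal.ofReal (1 - t) • q.measure) (fun ε hε => by
    obtain ⟨K, hK, hKp⟩ := p.exists_compact hε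
    obtain ⟨L, hL, hLq⟩ := q.exists_compact hε
    refine ⟨K ∪ L, hK.union hL, ?_⟩
    have h1 : p.measure (K ∪ L)ᶜ ≤ ε := (measure_mono (by simp)).trans hKp
    have h2 : q.measure (K ∪ L)ᶜ ≤ ε := (measure_mono (by simp)).trans hLq
    simp only [Measure.add_apply, Measure.smul_apply, smul_eq_mul]
    calc _ ≤ ENNReal.ofReal t * ε + ENNReal.ofReal (1 - t) * ε := by gcongr
      _ = ε := by
        rw [← add_mul, ← ENNReal.ofReal_add t.2.1 (sub_nonneg.2 t.2.2)]
        simp)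
    fun x₀ => ((p.integrable_dist x₀).smul_measure (by simp)).add_measure
      ((q.integrable_dist x₀).smul_measure (by simp))

theorem measure_mix (t : unitInterval) (p q : KantorovichSpace X) :
    (mix t p q).measure = ENNReal.ofReal t • p.measure + ENNReal.ofReal (1 - t) • q.measure := rfl

theorem integral_mix (t : unitInterval) (p q : KantorovichSpace X) {f : X → ℝ}
    (hf : LipschitzWith 1 f) : ∫ x, f x ∂(mix t p q).measure =
      t * ∫ x, f x ∂p.measure + (1 - t) * ∫ x, f x ∂q.measure := by
  rw [measure_mix, integral_add_measure ((p.integrable_of_short hf).smul_measure (by simp))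
    ((q.integrable_of_short hf).smul_measure (by simp)), integral_smul_measure,
    integral_smul_measure, ENNReal.toReal_ofReal t.2.1, ENNReal.toReal_ofReal (sub_nonneg.2 t.2.2)]
  rfl

/-- The finitely supported measure `∑ i ∈ s, w i • δ (x i)`. -/
noncomputable def finComb {ι : Type*} (s : Finset ι) (w : ι → ℝ) (x : ι → X)
    (hw : ∀ i ∈ s, 0 ≤ w i) (h1 : ∑ i ∈ s, w i = 1) : KantorovichSpace X :=
  have : IsProbabilityMeasure (∑ i ∈ s, ENNReal.ofReal (w i) • Measure.dirac (x i)) := ⟨by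
    simp only [Measure.finsetSum_apply, Measure.smul_apply, measure_univ, smul_eq_mul, mul_one]
    rw [← ENNReal.ofReal_sum_of_nonneg hw, h1, ENNReal.ofReal_one]⟩
  ofTight (∑ i ∈ s, ENNReal.ofReal (w i) • Measure.dirac (x i))
    (fun ε _ => ⟨x '' s, (s.finite_toSet.image x).isCompact, by
      rw [Measure.finsetSum_apply]
      refine (Finset.sum_eq_zero fun i hi => ?_).le.trans zero_le
      have : x i ∈ x '' s := ⟨i, hi, rfl⟩
      simp only [Measure.smul_apply, smul_eq_mul]
      rw [Measure.dirac_apply' _ (s.finite_toSet.image x).measurableSet.compl]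
      simp [this]⟩)
    fun x₀ => integrable_finsetSum_measure.2 fun i _ =>
      (integrable_dirac (by simp)).smul_measure (by simp)

theorem measure_finComb {ι : Type*} (s : Finset ι) (w : ι → ℝ) (x : ι → X)
    (hw : ∀ i ∈ s, 0 ≤ w i) (h1 : ∑ i ∈ s, w i = 1) :
    (finComb s w x hw h1).measure = ∑ i ∈ s, ENNReal.ofReal (w i) • Measure.dirac (x i) := rfl

theorem integral_finComb {ι : Type*} (s : Finset ι) (w : ι → ℝ) (x : ι → X)
    (hw : ∀ i ∈ s, 0 ≤ w i) (h1 : ∑ i ∈ s, w i = 1) (f : X → ℝ) :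
    ∫ y, f y ∂(finComb s w x hw h1).measure = ∑ i ∈ s, w i * f (x i) := by
  rw [measure_finComb, integral_finsetSum_measure fun i _ =>
    (integrable_dirac (by simp)).smul_measure (by simp)]
  refine Finset.sum_congr rfl fun i hi => ?_
  rw [integral_smul_measure, ENNReal.toReal_ofReal (hw i hi), MeasureTheory.integral_dirac]
  rfl

end Constructions

end KantorovichSpace

end KantorovichSpaces

section TightnessAndCompleteness

open Filter Topology

namespace KantorovichSpace

variable {X : Type u} [MetricSpace X] [MeasurableSpace X] [BorelSpace X]

/-! ### Tightness of totally bounded sets of measures -/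

/-- A totally bounded set of measures is uniformly concentrated, up to `η`, on a finite union of
balls of given radius: test the Wasserstein distance against the truncated distance to a compact
set that carries finitely many centres up to `η / 2`. -/
theorem exists_finite_biUnion_ball {S : Set (KantorovichSpace X)} (hS : TotallyBounded S)
    {δ η : ℝ} (hδ : 0 < δ) (hη : 0 < η) :
    ∃ F : Set X, F.Finite ∧
      ∀ p ∈ S, p.measure (⋃ x ∈ F, Metric.ball x (2 * δ))ᶜ ≤ ENNReal.ofReal η := by
  rcases isEmpty_or_nonempty X with hX | ⟨⟨x₀⟩⟩
  · exact ⟨∅, Set.finite_empty, fun p _ => (hX.false p.nonempty.some).elim⟩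
  obtain ⟨t, ht, hSt⟩ := Metric.totallyBounded_iff.1 hS (η * δ / 2) (by positivity)
  have hη2 : ENNReal.ofReal (η / 2) ≠ 0 := by simpa using hη
  choose C hC hCm using fun p : KantorovichSpace X => p.exists_compact hη2
  set K : Set X := insert x₀ (⋃ p ∈ t, C p) with hK
  have hKc : IsCompact K := (ht.isCompact_biUnion fun p _ => hC p).insert x₀
  have hKne : K.Nonempty := ⟨x₀, Set.mem_insert _ _⟩
  obtain ⟨F, hF, hKF⟩ := Metric.totallyBounded_iff.1 hKc.totallyBounded δ hδ
  refine ⟨F, hF, fun p hp => ?_⟩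
  obtain ⟨q, hqt, hpq⟩ := Set.mem_iUnion₂.1 (hSt hp)
  set f : X → ℝ := fun x => min δ (Metric.infDist x K) with hf
  have hfs : LipschitzWith 1 f := (Metric.lipschitz_infDist_pt K).const_min δ
  have hf0 : ∀ x, 0 ≤ f x := fun x => le_min hδ.le Metric.infDist_nonneg
  have hq : ∫ x, f x ∂q.measure ≤ δ * (η / 2) := by
    calc ∫ x, f x ∂q.measure ≤ ∫ x, (Kᶜ).indicator (fun _ => δ) x ∂q.measure := by
          refine integral_mono (q.integrable_of_short hfs)
            ((integrable_const δ).indicator hKc.measurableSet.compl) fun x => ?_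
          by_cases hx : x ∈ K
          · simp [hf, hx, Metric.infDist_zero_of_mem hx, hδ.le]
          · simp [hf, hx]
      _ = q.measure.real Kᶜ * δ := by
          rw [integral_indicator_const _ hKc.measurableSet.compl, smul_eq_mul]
      _ ≤ (η / 2) * δ := by
          gcongr
          refine ENNReal.toReal_le_of_le_ofReal (by positivity) ((measure_mono ?_).trans (hCm q))
          exact Set.compl_subset_compl.2
            ((Set.subset_biUnion_of_mem (u := C) hqt).trans (Set.subset_insert _ _))
      _ = δ * (η / 2) := mul_comm _ _
  have hp' : ∫ x, f x ∂p.measure ≤ δ * η := by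
    have := integral_sub_le_dist_symm p q hfs
    have h2 : dist p q < η * δ / 2 := hpq
    linarith
  have hM := mul_meas_ge_le_integral_of_nonneg (Eventually.of_forall hf0)
    (p.integrable_of_short hfs) δ
  have h3 : p.measure.real {x | δ ≤ f x} ≤ η := le_of_mul_le_mul_left (hM.trans hp') hδ
  have h4 : (⋃ x ∈ F, Metric.ball x (2 * δ))ᶜ ⊆ {x | δ ≤ f x} := by
    intro x hx
    refine le_min le_rfl ((Metric.le_infDist hKne).2 fun {k} hk => ?_)
    obtain ⟨z, hz, hkz⟩ := Set.mem_iUnion₂.1 (hKF hk)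
    have h5 : ¬ dist x z < 2 * δ := fun h => hx (Set.mem_iUnion₂.2 ⟨z, hz, h⟩)
    have h6 := dist_triangle x k z
    have h7 : dist k z < δ := hkz
    linarith [not_lt.1 h5]
  refine (measure_mono h4).trans ?_
  rw [← ENNReal.ofReal_toReal (measure_ne_top p.measure {x | δ ≤ f x})]
  exact ENNReal.ofReal_le_ofReal h3

/-- Totally bounded sets of measures are uniformly tight. -/
theorem exists_compact_of_totallyBounded [CompleteSpace X] {S : Set (KantorovichSpace X)}
    (hS : TotallyBounded S) {ε : ENNReal} (hε : ε ≠ 0) :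
    ∃ K, IsCompact K ∧ ∀ p ∈ S, p.measure Kᶜ ≤ ε := by
  obtain ⟨η, hη, hηε⟩ := ENNReal.exists_pos_sum_of_countable hε ℕ
  choose F hF hFS using fun n : ℕ => exists_finite_biUnion_ball hS
    (δ := 1 / ((n : ℝ) + 1)) (by positivity) (NNReal.coe_pos.2 (hη n))
  set K : Set X := ⋂ n : ℕ, ⋃ x ∈ F n, Metric.closedBall x (2 * (1 / ((n : ℝ) + 1))) with hK
  refine ⟨K, ?_, fun p hp => ?_⟩
  · refine TotallyBounded.isCompact_of_isClosed (Metric.totallyBounded_iff.2 fun δ hδ => ?_)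
      (isClosed_iInter fun n => (hF n).isClosed_biUnion fun x _ => Metric.isClosed_closedBall)
    obtain ⟨n, hn⟩ := exists_nat_one_div_lt (half_pos hδ)
    refine ⟨F n, hF n, (Set.iInter_subset _ n).trans (Set.iUnion₂_mono fun x _ => ?_)⟩
    exact Metric.closedBall_subset_ball (by linarith)
  · rw [hK, Set.compl_iInter]
    calc _ ≤ ∑' n : ℕ, p.measure (⋃ x ∈ F n, Metric.closedBall x (2 * (1 / ((n : ℝ) + 1))))ᶜ :=
          measure_iUnion_le _
      _ ≤ ∑' n : ℕ, (η n : ENNReal) := by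
          refine ENNReal.tsum_le_tsum fun n => ?_
          refine (measure_mono (Set.compl_subset_compl.2
            (Set.iUnion₂_mono fun x _ => Metric.ball_subset_closedBall))).trans ?_
          simpa using hFS n p hp
      _ ≤ ε := hηε.le

end KantorovichSpace

/-- A uniformly tight sequence of probability measures has a tight weak limit along a free
ultrafilter. -/
theorem exists_tendsto_hyperfilter_of_tight {Z : Type*} [MetricSpace Z] [MeasurableSpace Z]
    [BorelSpace Z] (μ : ℕ → Measure Z) [∀ n, IsProbabilityMeasure (μ n)]
    (h : ∀ ε : ENNReal, ε ≠ 0 → ∃ K, IsCompact K ∧ ∀ n, μ n Kᶜ ≤ ε) :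
    ∃ ν : Measure Z, IsProbabilityMeasure ν ∧
      (∀ ε : ENNReal, ε ≠ 0 → ∃ K, IsCompact K ∧ ν Kᶜ ≤ ε) ∧
      ∀ f : Z → ℝ, Continuous f → (∃ M, ∀ x, |f x| ≤ M) →
        Tendsto (fun n => ∫ x, f x ∂(μ n)) (hyperfilter ℕ) (𝓝 (∫ x, f x ∂ν)) := by
  obtain ⟨v, -, hv0, hv⟩ := exists_seq_strictAnti_tendsto (0 : NNReal)
  choose K hK hKμ using fun n : ℕ => h (v n) (by simpa using (hv0 n).ne')
  have hcomp := isCompact_setOfPred_probabilityMeasure_mass_eq_compl_isCompact_le hv hK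
    (Or.inl inferInstance)
  set m : ℕ → ProbabilityMeasure Z := fun n => ⟨μ n, inferInstance⟩ with hm
  obtain ⟨ν, hνS, hν⟩ := hcomp.ultrafilter_le_nhds' ((hyperfilter ℕ).map m) (by
    refine Ultrafilter.mem_map.2 (Filter.univ_mem' fun n i => ?_)
    have := hKμ i n
    rw [← ENNReal.coe_le_coe, ProbabilityMeasure.ennreal_coeFn_eq_coeFn_toMeasure]
    exact this)
  refine ⟨ν, inferInstance, fun ε hε => ?_, fun f hf ⟨M, hM⟩ => ?_⟩
  · obtain ⟨n, hn⟩ : ∃ n, (v n : ENNReal) < ε :=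
      (((ENNReal.tendsto_coe.2 hv).eventually (gt_mem_nhds (by simpa using hε.bot_lt)))).exists
    refine ⟨K n, hK n, le_trans ?_ hn.le⟩
    have := ENNReal.coe_le_coe.2 (hνS n)
    rwa [ProbabilityMeasure.ennreal_coeFn_eq_coeFn_toMeasure] at this
  · have ht : Tendsto m (hyperfilter ℕ) (𝓝 ν) := hν
    exact ProbabilityMeasure.tendsto_iff_forall_integral_tendsto.1 ht
      (BoundedContinuousFunction.ofNormedAddCommGroup f hf M hM)

namespace KantorovichSpace

variable {X : Type u} [MetricSpace X] [MeasurableSpace X] [BorelSpace X]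

/-! ### Completeness -/

/-- A weak limit along an ultrafilter of a Wasserstein-bounded sequence has finite first
moment. -/
theorem integrable_dist_of_tendsto {p : ℕ → KantorovichSpace X} {ν : Measure X}
    [IsProbabilityMeasure ν]
    (hν : ∀ f : X → ℝ, Continuous f → (∃ M, ∀ x, |f x| ≤ M) →
      Tendsto (fun n => ∫ x, f x ∂(p n).measure) (hyperfilter ℕ) (𝓝 (∫ x, f x ∂ν)))
    (x₀ : X) {C : ℝ} (hC : ∀ n, ∫ x, dist x x₀ ∂(p n).measure ≤ C) :
    Integrable (fun x => dist x x₀) ν := by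
  have hd : LipschitzWith 1 fun x => dist x x₀ := LipschitzWith.dist_left x₀
  have hmeas : Measurable fun x => dist x x₀ := hd.continuous.measurable
  have hb : ∀ M : ℕ, ∫⁻ x, ENNReal.ofReal (min (M : ℝ) (dist x x₀)) ∂ν ≤ ENNReal.ofReal C := by
    intro M
    have hs : LipschitzWith 1 fun x => min (M : ℝ) (dist x x₀) := hd.const_min _
    have h0 : ∀ x, 0 ≤ min (M : ℝ) (dist x x₀) := fun x => le_min (Nat.cast_nonneg _) dist_nonneg
    have hbd : ∀ x, |min (M : ℝ) (dist x x₀)| ≤ M := fun x => by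
      rw [abs_of_nonneg (h0 x)]; exact min_le_left _ _
    rw [← ofReal_integral_eq_lintegral_ofReal
      (Integrable.of_bound hs.continuous.aestronglyMeasurable M (Eventually.of_forall hbd))
      (Eventually.of_forall h0)]
    refine ENNReal.ofReal_le_ofReal (le_of_tendsto' (hν _ hs.continuous ⟨M, hbd⟩) fun n => ?_)
    exact (integral_mono ((p n).integrable_of_short hs) ((p n).integrable_of_short hd)
      fun x => min_le_right _ _).trans (hC n)
  refine ⟨hmeas.aestronglyMeasurable, ?_⟩
  rw [hasFiniteIntegral_iff_ofReal (Eventually.of_forall fun x => dist_nonneg)]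
  refine lt_of_le_of_lt ?_ (ENNReal.ofReal_lt_top (r := C))
  have hsup : ∀ x, ENNReal.ofReal (dist x x₀) =
      ⨆ M : ℕ, ENNReal.ofReal (min (M : ℝ) (dist x x₀)) := fun x => by
    refine le_antisymm ?_ (iSup_le fun M => ENNReal.ofReal_le_ofReal (min_le_right _ _))
    obtain ⟨M, hM⟩ := exists_nat_ge (dist x x₀)
    exact (le_of_eq (by rw [min_eq_right hM])).trans
      (le_iSup (fun M : ℕ => ENNReal.ofReal (min (M : ℝ) (dist x x₀))) M)
  simp_rw [hsup]
  rw [lintegral_iSup (fun M => (measurable_const.min hmeas).ennreal_ofReal)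
    (fun M N hMN x => ENNReal.ofReal_le_ofReal (min_le_min_right _ (by exact_mod_cast hMN)))]
  exact iSup_le hb

instance [CompleteSpace X] : CompleteSpace (KantorovichSpace X) := by
  refine Metric.complete_of_cauchySeq_tendsto fun p hp => ?_
  obtain ⟨ν, hνp, hνt, hν⟩ := exists_tendsto_hyperfilter_of_tight (fun n => (p n).measure)
    fun ε hε => by
      obtain ⟨K, hK, hKp⟩ := exists_compact_of_totallyBounded hp.totallyBounded_range hε
      exact ⟨K, hK, fun n => hKp _ ⟨n, rfl⟩⟩
  have hint : ∀ x₀, Integrable (fun x => dist x x₀) ν := fun x₀ => by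
    obtain ⟨R, hR, hpR⟩ := cauchySeq_bdd hp
    refine integrable_dist_of_tendsto hν x₀ (C := (∫ x, dist x x₀ ∂(p 0).measure) + R) fun n => ?_
    have h1 := integral_sub_le_dist (p 0) (p n) (LipschitzWith.dist_left x₀)
    have h2 := hpR 0 n
    linarith
  refine ⟨ofTight ν hνt hint, Metric.tendsto_atTop.2 fun ε hε => ?_⟩
  obtain ⟨N, hN⟩ := Metric.cauchySeq_iff.1 hp (ε / 2) (half_pos hε)
  refine ⟨N, fun n hn => lt_of_le_of_lt ?_ (half_lt_self hε)⟩
  refine dist_le_of_forall_bounded fun f hf hM => ?_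
  refine le_of_tendsto ((hν f hf.continuous hM).sub_const _) ?_
  filter_upwards [Nat.hyperfilter_le_atTop (eventually_ge_atTop N)] with m hm
  exact (integral_sub_le_dist (p n) (p m) hf).trans (hN n hn m hm).le

/-! ### Density of finitely supported measures -/

theorem exists_isSeparable (p : KantorovichSpace X) :
    ∃ S : Set X, TopologicalSpace.IsSeparable S ∧ ∀ᵐ x ∂p.measure, x ∈ S := by
  choose K hK hKp using fun n : ℕ => p.exists_compact (ε := ENNReal.ofReal (1 / ((n : ℝ) + 1)))
    (by rw [Ne, ENNReal.ofReal_eq_zero, not_le]; positivity)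
  refine ⟨⋃ n, K n, TopologicalSpace.IsSeparable.iUnion fun n => (hK n).isSeparable, ?_⟩
  refine measure_mono_null (t := ⋂ n, (K n)ᶜ)
    (fun x hx => Set.mem_iInter.2 fun n hxn => hx (Set.mem_iUnion.2 ⟨n, hxn⟩)) ?_
  refine le_antisymm (ge_of_tendsto' (x := atTop)
    (f := fun n : ℕ => ENNReal.ofReal (1 / ((n : ℝ) + 1)))
    ?_ fun n => (measure_mono (Set.iInter_subset _ n)).trans (hKp n)) zero_le
  simpa using ENNReal.tendsto_ofReal (tendsto_one_div_add_atTop_nhds_zero_nat (𝕜 := ℝ))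

/-- The finitely supported measures are dense. -/
theorem exists_finComb_dist_lt (p : KantorovichSpace X) {ε : ℝ} (hε : 0 < ε) :
    ∃ (s : Finset X) (w : X → ℝ) (hw : ∀ i ∈ s, 0 ≤ w i) (h1 : ∑ i ∈ s, w i = 1),
      dist p (finComb s w id hw h1) < ε := by
  obtain ⟨x₀⟩ := p.nonempty
  obtain ⟨S₀, hS₀, hS₀p⟩ := p.exists_isSeparable
  set S : Set X := insert x₀ S₀ with hS
  have hSsep : TopologicalSpace.IsSeparable S := by
    rw [hS, Set.insert_eq]
    exact (Set.finite_singleton x₀).isSeparable.union hS₀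
  have hSae : ∀ᵐ x ∂p.measure, x ∈ S := hS₀p.mono fun x hx => Set.mem_insert_of_mem _ hx
  have := hSsep.separableSpace
  have h0 : x₀ ∈ S := Set.mem_insert _ _
  set g : ℕ → SimpleFunc X X := fun n => SimpleFunc.approxOn id measurable_id S x₀ h0 n with hg
  have hgm : ∀ n, Measurable fun x => dist x (g n x) := fun n =>
    (SimpleFunc.measurable_bind (g n) (fun z x => dist x z) fun z =>
      (continuous_id.dist continuous_const).measurable)
  have hgd : ∀ n x, dist x (g n x) ≤ dist x x₀ := fun n x => by
    have := SimpleFunc.edist_approxOn_le (f := id) measurable_id h0 x n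
    rw [edist_dist, edist_dist, ENNReal.ofReal_le_ofReal_iff dist_nonneg] at this
    rw [dist_comm, dist_comm x]
    exact this
  have hlim : Tendsto (fun n => ∫ x, dist x (g n x) ∂p.measure) atTop (𝓝 0) := by
    have := tendsto_integral_of_dominated_convergence (μ := p.measure)
      (F := fun n x => dist x (g n x)) (f := fun _ => 0) (fun x => dist x x₀)
      (fun n => (hgm n).aestronglyMeasurable) (p.integrable_dist x₀)
      (fun n => Eventually.of_forall fun x => by
        rw [Real.norm_of_nonneg dist_nonneg]; exact hgd n x)
      (by
        filter_upwards [hSae] with x hx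
        have h := SimpleFunc.tendsto_approxOn (f := id) measurable_id h0 (x := x)
          (subset_closure hx)
        simpa using (tendsto_const_nhds (x := x)).dist h)
    simpa using this
  obtain ⟨n, hn⟩ := (hlim.eventually (gt_mem_nhds hε)).exists
  have hsum : ∀ f : X → ℝ, ∫ x, f (g n x) ∂p.measure =
      ∑ y ∈ (g n).range, p.measure.real (g n ⁻¹' {y}) * f y := by
    intro f
    have h1 : ∀ x, f (g n x) = ∑ y ∈ (g n).range, (g n ⁻¹' {y}).indicator (fun _ => f y) x := by
      intro x
      rw [Finset.sum_eq_single_of_mem (g n x) ((g n).mem_range_self x)]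
      · simp
      · intro y _ hy
        exact Set.indicator_of_notMem (fun h => hy (by simpa using h.symm)) _
    simp_rw [h1]
    rw [integral_finsetSum _ fun y _ =>
      (integrable_const (f y)).indicator ((g n).measurableSet_fiber y)]
    refine Finset.sum_congr rfl fun y _ => ?_
    rw [integral_indicator_const _ ((g n).measurableSet_fiber y), smul_eq_mul]
  refine ⟨(g n).range, fun y => p.measure.real (g n ⁻¹' {y}), fun _ _ => measureReal_nonneg,
    by simpa using (hsum fun _ => 1).symm, ?_⟩
  refine lt_of_le_of_lt (dist_le_of_forall fun f hf => ?_) hn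
  have hi : Integrable (fun x => dist x (g n x)) p.measure :=
    (p.integrable_dist x₀).mono' (hgm n).aestronglyMeasurable (Eventually.of_forall fun x => by
      rw [Real.norm_of_nonneg dist_nonneg]; exact hgd n x)
  have hig : Integrable (fun x => f (g n x)) p.measure := by
    have := ((g n).map f).integrable_of_isFiniteMeasure (μ := p.measure)
    simpa [Function.comp_def] using this
  rw [integral_finComb]
  simp only [id]
  rw [← hsum f, ← integral_sub hig (p.integrable_of_short hf)]
  refine integral_mono (hig.sub (p.integrable_of_short hf)) hi fun x => ?_
  have := hf.dist_le_mul (g n x) x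
  rw [NNReal.coe_one, one_mul, dist_comm _ x, Real.dist_eq] at this
  exact (le_abs_self _).trans this

end KantorovichSpace

end TightnessAndCompleteness

section StochasticOrder

open Filter Topology

/-! ### Finite optimal transport -/

/-- Linear programming duality for finite transport problems, obtained by separating the compact
convex set of pairs (second marginal, cost) of the plans with first marginal `a` from the ray
`{b} × (-∞, m]`. -/
theorem exists_transportPlan {ι κ : Type*} [Fintype ι] [Fintype κ] [Nonempty κ] (a : ι → ℝ)
    (b : κ → ℝ) (ha : ∀ i, 0 ≤ a i) (hb : ∀ j, 0 ≤ b j) (ha1 : ∑ i, a i = 1) (hb1 : ∑ j, b j = 1)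
    (c : ι → κ → ℝ) (m : ℝ)
    (h : ∀ (g : κ → ℝ) (h : ι → ℝ), (∀ i j, g j - h i ≤ c i j) →
      ∑ j, b j * g j - ∑ i, a i * h i ≤ m) :
    ∃ r : ι → κ → ℝ, (∀ i j, 0 ≤ r i j) ∧ (∀ i, ∑ j, r i j = a i) ∧ (∀ j, ∑ i, r i j = b j) ∧
      ∑ i, ∑ j, r i j * c i j ≤ m := by
  classical
  by_contra hno
  set T : Set (ι → κ → ℝ) := {r | (∀ i j, 0 ≤ r i j) ∧ ∀ i, ∑ j, r i j = a i} with hT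
  set Φ : (ι → κ → ℝ) → (κ → ℝ) × ℝ :=
    fun r => (fun j => ∑ i, r i j, ∑ i, ∑ j, r i j * c i j) with hΦ
  have hΦlin : IsLinearMap ℝ Φ := by
    refine ⟨fun r s => ?_, fun t r => ?_⟩
    · simp only [hΦ, Prod.mk_add_mk, Pi.add_apply, add_mul, Finset.sum_add_distrib]
      rfl
    · simp only [hΦ, Prod.smul_mk, Pi.smul_apply, smul_eq_mul, mul_assoc, Finset.mul_sum]
      congr 1
      funext j
      simp [Finset.mul_sum]
  have hΦcont : Continuous Φ := by fun_prop
  have hTcl : IsClosed T := by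
    have h1 : IsClosed {r : ι → κ → ℝ | ∀ i j, 0 ≤ r i j} := by
      simp only [Set.ofPred_forall]
      exact isClosed_iInter fun i => isClosed_iInter fun j =>
        isClosed_le continuous_const (by fun_prop)
    have h2 : IsClosed {r : ι → κ → ℝ | ∀ i, ∑ j, r i j = a i} := by
      simp only [Set.ofPred_forall]
      exact isClosed_iInter fun i => isClosed_eq (by fun_prop) continuous_const
    exact h1.inter h2
  have hTsub : T ⊆ Set.Icc 0 fun i _ => a i := fun r hr =>
    ⟨fun i j => hr.1 i j, fun i j => (Finset.single_le_sum
      (f := fun j => r i j) (fun j _ => hr.1 i j) (Finset.mem_univ j)).trans_eq (hr.2 i)⟩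
  have hTc : IsCompact T := isCompact_Icc.of_isClosed_subset hTcl hTsub
  have hTconv : Convex ℝ T := by
    intro r hr s hs t t' ht ht' htt
    refine ⟨fun i j => add_nonneg (mul_nonneg ht (hr.1 i j)) (mul_nonneg ht' (hs.1 i j)),
      fun i => ?_⟩
    simp only [Pi.add_apply, Pi.smul_apply, smul_eq_mul, Finset.sum_add_distrib, ← Finset.mul_sum,
      hr.2 i, hs.2 i]
    rw [← add_mul, htt, one_mul]
  have hG : Convex ℝ (Φ '' T) := hTconv.is_linear_image hΦlin
  have hD : Convex ℝ (({b} : Set (κ → ℝ)) ×ˢ Set.Iic m) := (convex_singleton b).prod (convex_Iic m)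
  have hDc : IsClosed (({b} : Set (κ → ℝ)) ×ˢ Set.Iic m) := isClosed_singleton.prod isClosed_Iic
  have hdisj : Disjoint (Φ '' T) (({b} : Set (κ → ℝ)) ×ˢ Set.Iic m) := by
    rw [Set.disjoint_left]
    rintro _ ⟨r, hr, rfl⟩ ⟨h1, h2⟩
    exact hno ⟨r, hr.1, hr.2, fun j => congrFun h1 j, h2⟩
  obtain ⟨f, α, β, hfG, hαβ, hfD⟩ :=
    geometric_hahn_banach_compact_closed hG (hTc.image hΦcont) hD hDc hdisj
  set g : κ → ℝ := fun j => f (Pi.single j 1, 0) with hg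
  set l : ℝ := f (0, 1) with hl
  have hfexp : ∀ (z : κ → ℝ) (s : ℝ), f (z, s) = ∑ j, z j * g j + s * l := by
    intro z s
    have h1 : (z, s) = ∑ j, z j • ((Pi.single j 1, 0) : (κ → ℝ) × ℝ) + s • (0, 1) := by
      refine Prod.ext ?_ ?_
      · rw [Prod.fst_add, Prod.fst_sum]
        funext k
        simp [Finset.sum_apply, Pi.single_apply]
      · simp [Prod.snd_sum]
    rw [h1, map_add, map_sum]
    simp only [map_smul, smul_eq_mul, hg, hl]
  have hfT : ∀ r ∈ T, ∑ i, ∑ j, r i j * (g j + c i j * l) < α := by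
    intro r hr
    have := hfG _ ⟨r, hr, rfl⟩
    rw [hΦ, hfexp] at this
    simp only [Finset.sum_mul] at this
    rw [Finset.sum_comm, ← Finset.sum_add_distrib] at this
    simpa only [mul_add, Finset.sum_add_distrib, mul_assoc] using this
  have hfb : ∀ s ≤ m, β < ∑ j, b j * g j + s * l := fun s hs => by
    rw [← hfexp]; exact hfD _ ⟨rfl, hs⟩
  -- the product plan has the right marginals, so the functional must see the cost
  have hprod : ∑ j, b j * g j + (∑ i, ∑ j, a i * b j * c i j) * l < α := by
    have := hfT (fun i j => a i * b j) ⟨fun i j => mul_nonneg (ha i) (hb j), fun i => by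
      rw [← Finset.mul_sum, hb1, mul_one]⟩
    have h2 : ∑ i, ∑ j, a i * b j * (g j + c i j * l) =
        ∑ j, b j * g j + (∑ i, ∑ j, a i * b j * c i j) * l := by
      simp only [mul_add, Finset.sum_add_distrib, Finset.sum_mul, mul_assoc, ← Finset.mul_sum]
      simp only [← Finset.sum_mul, ha1, one_mul]
    rwa [h2] at this
  have hl0 : l < 0 := by
    by_contra hl0
    rw [not_lt] at hl0
    have h1 := hfb (min m (∑ i, ∑ j, a i * b j * c i j)) (min_le_left _ _)
    have h2 := mul_le_mul_of_nonneg_right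
      (min_le_right m (∑ i, ∑ j, a i * b j * c i j)) hl0
    linarith
  -- the plan that moves every `i` to an optimal `J i`
  choose J hJ using fun i => Finite.exists_max fun j => g j + c i j * l
  have hopt := hfT (fun i j => if j = J i then a i else 0)
    ⟨fun i j => by dsimp only; split_ifs; exacts [ha i, le_rfl], fun i => by simp⟩
  simp only [ite_mul, zero_mul, Finset.sum_ite_eq', Finset.mem_univ, if_true] at hopt
  have hfin := h (fun j => g j / (-l)) (fun i => (g (J i) + c i (J i) * l) / (-l)) fun i j => by
    rw [← sub_div, div_le_iff₀ (by linarith)]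
    have := hJ i j
    linarith
  have h3 : ∑ j, b j * (g j / (-l)) - ∑ i, a i * ((g (J i) + c i (J i) * l) / (-l)) =
      (∑ j, b j * g j - ∑ i, a i * (g (J i) + c i (J i) * l)) / (-l) := by
    rw [sub_div, Finset.sum_div, Finset.sum_div]
    simp only [mul_div_assoc]
  rw [h3, div_le_iff₀ (by linarith)] at hfin
  have := hfb m le_rfl
  linarith

/-! ### The cost detecting the order -/

section OrderCost

theorem LipschitzWith.sub_le_dist {X : Type*} [MetricSpace X] {f : X → ℝ} (hf : LipschitzWith 1 f)
    (x y : X) : f x - f y ≤ dist x y := by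
  have := hf.dist_le_mul x y
  rw [NNReal.coe_one, one_mul, Real.dist_eq] at this
  exact (le_abs_self _).trans this

variable {X : Type u} [MetricSpace X] [PartialOrder X]

/-- The cost `c x y = sup (f x - f y)`, where `f` ranges over the short monotone functions. It is
an asymmetric distance that vanishes exactly when `x ≤ y`, if the space is L-ordered. -/
noncomputable def orderCost (x y : X) : ℝ :=
  sSup {r : ℝ | ∃ f : X → ℝ, LipschitzWith 1 f ∧ Monotone f ∧ r = f x - f y}

theorem isLUB_orderCost (x y : X) :
    IsLUB {r : ℝ | ∃ f : X → ℝ, LipschitzWith 1 f ∧ Monotone f ∧ r = f x - f y}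
      (orderCost x y) := by
  refine isLUB_csSup ⟨0, fun _ => 0, (LipschitzWith.const (0 : ℝ)).weaken zero_le_one,
    monotone_const, by simp⟩ ⟨dist x y, ?_⟩
  rintro r ⟨f, hf, -, rfl⟩
  exact hf.sub_le_dist x y

theorem sub_le_orderCost {f : X → ℝ} (hf : LipschitzWith 1 f) (hm : Monotone f) (x y : X) :
    f x - f y ≤ orderCost x y := (isLUB_orderCost x y).1 ⟨f, hf, hm, rfl⟩

theorem orderCost_le {x y : X} {C : ℝ}
    (h : ∀ f : X → ℝ, LipschitzWith 1 f → Monotone f → f x - f y ≤ C) : orderCost x y ≤ C :=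
  (isLUB_orderCost x y).2 (by rintro r ⟨f, hf, hm, rfl⟩; exact h f hf hm)

theorem orderCost_nonneg (x y : X) : 0 ≤ orderCost x y := by
  simpa using sub_le_orderCost ((LipschitzWith.const (0 : ℝ)).weaken zero_le_one) monotone_const x y

theorem orderCost_le_dist (x y : X) : orderCost x y ≤ dist x y :=
  orderCost_le fun _ hf _ => hf.sub_le_dist x y

theorem orderCost_triangle (x y z : X) : orderCost x z ≤ orderCost x y + orderCost y z :=
  orderCost_le fun f hf hm => by
    have h1 := sub_le_orderCost hf hm x y
    have h2 := sub_le_orderCost hf hm y z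
    linarith

theorem orderCost_eq_zero_of_le {x y : X} (h : x ≤ y) : orderCost x y = 0 :=
  le_antisymm (orderCost_le fun _ _ hm => sub_nonpos.2 (hm h)) (orderCost_nonneg x y)

theorem IsLOrdered.le_of_orderCost_le_zero (hL : IsLOrdered X) {x y : X} (h : orderCost x y ≤ 0) :
    x ≤ y := (hL x y).2 fun _ hf hm => sub_nonpos.1 ((sub_le_orderCost hf hm x y).trans h)

/-- Functions that are nonexpansive for the order cost are short and monotone. -/
theorem short_and_monotone_of_sub_le_orderCost {f : X → ℝ}
    (h : ∀ x y, f x - f y ≤ orderCost x y) : LipschitzWith 1 f ∧ Monotone f := by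
  refine ⟨LipschitzWith.of_dist_le_mul fun x y => ?_, fun x y hxy => ?_⟩
  · rw [NNReal.coe_one, one_mul, Real.dist_eq, abs_le]
    have h1 := (h x y).trans (orderCost_le_dist x y)
    have h2 := (h y x).trans (orderCost_le_dist y x)
    rw [dist_comm] at h2
    constructor <;> linarith
  · have := h x y
    rw [orderCost_eq_zero_of_le hxy] at this
    linarith

theorem continuous_orderCost : Continuous fun z : X × X => orderCost z.1 z.2 := by
  have : LipschitzWith 2 fun z : X × X => orderCost z.1 z.2 := by
    refine LipschitzWith.of_le_add_mul 2 fun z w => ?_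
    have h1 := orderCost_triangle z.1 w.1 z.2
    have h2 := orderCost_triangle w.1 w.2 z.2
    have h3 := orderCost_le_dist z.1 w.1
    have h4 := orderCost_le_dist w.2 z.2
    have h5 : dist z.1 w.1 ≤ dist z w := le_max_left _ _
    have h6 : dist z.2 w.2 ≤ dist z w := le_max_right _ _
    rw [dist_comm w.2] at h4
    rw [NNReal.coe_ofNat]
    linarith
  exact this.continuous

end OrderCost

/-! ### Monotone Kantorovich duality -/

section Duality

variable {X : Type u} [MetricSpace X] [PartialOrder X] [MeasurableSpace X] [BorelSpace X]

open KantorovichSpace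

/-- Finitely supported measures `p'`, `q'` close to measures with `∫ f dp ≤ ∫ f dq` for all short
monotone `f` have a coupling of small order cost. -/
theorem exists_coupling_finComb [MeasurableSpace (X × X)] [BorelSpace (X × X)]
    {p q : KantorovichSpace X}
    (h : ∀ f : X → ℝ, LipschitzWith 1 f → Monotone f →
      ∫ x, f x ∂p.measure ≤ ∫ x, f x ∂q.measure)
    {s t : Finset X} {a b : X → ℝ} (ha : ∀ i ∈ s, 0 ≤ a i) (ha1 : ∑ i ∈ s, a i = 1)
    (hb : ∀ i ∈ t, 0 ≤ b i) (hb1 : ∑ i ∈ t, b i = 1) {ε : ℝ}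
    (hp : dist p (finComb s a id ha ha1) < ε) (hq : dist q (finComb t b id hb hb1) < ε) :
    ∃ r : KantorovichSpace (X × X),
      (∀ f : X → ℝ, ∫ z, f z.1 ∂r.measure = ∫ x, f x ∂(finComb s a id ha ha1).measure) ∧
      (∀ f : X → ℝ, ∫ z, f z.2 ∂r.measure = ∫ x, f x ∂(finComb t b id hb hb1).measure) ∧
      ∫ z, orderCost z.1 z.2 ∂r.measure ≤ 2 * ε := by
  have htne : t.Nonempty := by
    rw [Finset.nonempty_iff_ne_empty]
    rintro rfl
    simp at hb1
  have : Nonempty t := htne.to_subtype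
  obtain ⟨r, hr0, hra, hrb, hrc⟩ := exists_transportPlan (fun i : s => a i) (fun j : t => b j)
    (fun i => ha i i.2) (fun j => hb j j.2) (by rw [Finset.sum_coe_sort s a, ha1])
    (by rw [Finset.sum_coe_sort t b, hb1]) (fun i j => orderCost (i : X) (j : X)) (2 * ε) (by
      intro g k hgk
      -- the `c`-transform of `g`
      set F : X → ℝ := fun x => Finset.univ.inf' Finset.univ_nonempty
        fun j : t => orderCost x j - g j with hF
      have hFj : ∀ x (j : t), F x ≤ orderCost x j - g j := fun x j =>
        Finset.inf'_le _ (Finset.mem_univ j)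
      obtain ⟨hFs, hFm⟩ := short_and_monotone_of_sub_le_orderCost (f := F) (by
        intro x y
        rw [sub_le_iff_le_add]
        obtain ⟨j, -, hj⟩ := Finset.exists_mem_eq_inf' Finset.univ_nonempty
          fun j : t => orderCost y j - g j
        have h1 := hFj x j
        have h2 := orderCost_triangle x y j
        have h3 : F y = orderCost y j - g j := hj
        linarith)
      have h1 := integral_sub_le_dist p (finComb s a id ha ha1) hFs
      have h2 := integral_sub_le_dist_symm q (finComb t b id hb hb1) hFs
      have h3 := integral_sub_le_dist_symm p (finComb s a id ha ha1) hFs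
      have h4 := h F hFs hFm
      rw [integral_finComb, ← Finset.sum_coe_sort] at h1 h2
      have h5 : ∑ j : t, b j * g j ≤ - ∑ j : t, b j * F j := by
        rw [← Finset.sum_neg_distrib]
        refine Finset.sum_le_sum fun j _ => ?_
        have := hFj j j
        rw [orderCost_eq_zero_of_le le_rfl] at this
        nlinarith [hb j j.2]
      have h6 : - ∑ i : s, a i * k i ≤ ∑ i : s, a i * F i := by
        rw [← Finset.sum_neg_distrib]
        refine Finset.sum_le_sum fun i _ => ?_
        have : - k i ≤ F i := Finset.le_inf' _ _ fun j _ => by linarith [hgk i j]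
        nlinarith [ha i i.2]
      simp only [id] at h1 h2
      linarith)
  have hw1 : ∑ z : s × t, r z.1 z.2 = 1 := by
    rw [Fintype.sum_prod_type]
    simp_rw [hra]
    rw [Finset.sum_coe_sort s a, ha1]
  refine ⟨finComb Finset.univ (fun z : s × t => r z.1 z.2) (fun z => ((z.1 : X), (z.2 : X)))
    (fun z _ => hr0 _ _) hw1, fun f => ?_, fun f => ?_, ?_⟩
  · rw [integral_finComb _ _ _ _ _ fun z : X × X => f z.1, integral_finComb, Fintype.sum_prod_type,
      ← Finset.sum_coe_sort s]
    simp only [← Finset.sum_mul, hra, id]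
  · rw [integral_finComb _ _ _ _ _ fun z : X × X => f z.2, integral_finComb,
      Fintype.sum_prod_type_right, ← Finset.sum_coe_sort t]
    simp only [← Finset.sum_mul, hrb, id]
  · rw [integral_finComb _ _ _ _ _ fun z : X × X => orderCost z.1 z.2, Fintype.sum_prod_type]
    exact hrc

/-- **Monotone Kantorovich duality**: if `∫ f dp ≤ ∫ f dq` for all short monotone `f`, there is a
Radon coupling of `p` and `q` supported on the graph of the order. It is a weak limit of couplings
of finitely supported approximations whose order cost tends to zero. -/
theorem exists_coupling_of_forall_integral_le [CompleteSpace X] [MeasurableSpace (X × X)]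
    [BorelSpace (X × X)] (hL : IsLOrdered X) {p q : KantorovichSpace X}
    (h : ∀ f : X → ℝ, LipschitzWith 1 f → Monotone f →
      ∫ x, f x ∂p.measure ≤ ∫ x, f x ∂q.measure) :
    ∃ r : Measure (X × X), r.InnerRegular ∧ r.map Prod.fst = p.measure ∧
      r.map Prod.snd = q.measure ∧ r {z | ¬ z.1 ≤ z.2} = 0 := by
  have hε : ∀ n : ℕ, (0 : ℝ) < 1 / ((n : ℝ) + 1) := fun n => by positivity
  choose s a ha ha1 hp using fun n => p.exists_finComb_dist_lt (hε n)
  choose t b hb hb1 hq using fun n => q.exists_finComb_dist_lt (hε n)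
  choose r hr1 hr2 hrc using fun n =>
    exists_coupling_finComb h (ha n) (ha1 n) (hb n) (hb1 n) (hp n) (hq n)
  set p' : ℕ → KantorovichSpace X := fun n => finComb (s n) (a n) id (ha n) (ha1 n) with hp'
  set q' : ℕ → KantorovichSpace X := fun n => finComb (t n) (b n) id (hb n) (hb1 n) with hq'
  have hlim0 := tendsto_one_div_add_atTop_nhds_zero_nat (𝕜 := ℝ)
  have hpl : Tendsto p' atTop (𝓝 p) := by
    refine tendsto_iff_dist_tendsto_zero.2 (squeeze_zero (fun _ => dist_nonneg)
      (fun n => ?_) hlim0)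
    rw [dist_comm]; exact (hp n).le
  have hql : Tendsto q' atTop (𝓝 q) := by
    refine tendsto_iff_dist_tendsto_zero.2 (squeeze_zero (fun _ => dist_nonneg)
      (fun n => ?_) hlim0)
    rw [dist_comm]; exact (hq n).le
  have hm1 : ∀ n, (r n).measure.map Prod.fst = (p' n).measure := fun n => by
    have := Measure.isProbabilityMeasure_map (μ := (r n).measure)
      (continuous_fst.measurable (α := X × X) (γ := X)).aemeasurable
    refine Measure.ext_of_forall_short fun f hf _ => ?_
    rw [MeasureTheory.integral_map continuous_fst.measurable.aemeasurable
      hf.continuous.aestronglyMeasurable, hr1]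
  have hm2 : ∀ n, (r n).measure.map Prod.snd = (q' n).measure := fun n => by
    have := Measure.isProbabilityMeasure_map (μ := (r n).measure)
      (continuous_snd.measurable (α := X × X) (γ := X)).aemeasurable
    refine Measure.ext_of_forall_short fun f hf _ => ?_
    rw [MeasureTheory.integral_map continuous_snd.measurable.aemeasurable
      hf.continuous.aestronglyMeasurable, hr2]
  obtain ⟨ν, hνp, hνt, hν⟩ := exists_tendsto_hyperfilter_of_tight (fun n => (r n).measure)
    fun ε hε => by
      have hε2 : ε / 2 ≠ 0 := by simpa using hε
      obtain ⟨K, hK, hKp⟩ := exists_compact_of_totallyBounded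
        hpl.cauchySeq.totallyBounded_range hε2
      obtain ⟨L, hLc, hLq⟩ := exists_compact_of_totallyBounded
        hql.cauchySeq.totallyBounded_range hε2
      refine ⟨K ×ˢ L, hK.prod hLc, fun n => ?_⟩
      rw [Set.compl_prod_eq_union, ← ENNReal.add_halves ε]
      refine (measure_union_le _ _).trans (add_le_add ?_ ?_)
      · have := hKp _ ⟨n, rfl⟩
        rw [← hm1, Measure.map_apply continuous_fst.measurable hK.measurableSet.compl] at this
        convert! this using 2
        ext z
        simp
      · have := hLq _ ⟨n, rfl⟩
        rw [← hm2, Measure.map_apply continuous_snd.measurable hLc.measurableSet.compl] at this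
        convert! this using 2
        ext z
        simp
  have hU : (hyperfilter ℕ : Filter ℕ) ≤ atTop := Nat.hyperfilter_le_atTop
  have hfst := Measure.isProbabilityMeasure_map (μ := ν)
      (continuous_fst.measurable (α := X × X) (γ := X)).aemeasurable
  have hsnd := Measure.isProbabilityMeasure_map (μ := ν)
      (continuous_snd.measurable (α := X × X) (γ := X)).aemeasurable
  refine ⟨ν, ν.innerRegular_of_tight hνt, ?_, ?_, ?_⟩
  · refine Measure.ext_of_forall_short fun f hf ⟨M, hM⟩ => ?_
    rw [MeasureTheory.integral_map continuous_fst.measurable.aemeasurable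
      hf.continuous.aestronglyMeasurable]
    refine tendsto_nhds_unique (hν _ (hf.continuous.comp continuous_fst) ⟨M, fun z => hM z.1⟩) ?_
    simp only [hr1]
    exact (((short_integral hf).continuous.tendsto p).comp hpl).mono_left hU
  · refine Measure.ext_of_forall_short fun f hf ⟨M, hM⟩ => ?_
    rw [MeasureTheory.integral_map continuous_snd.measurable.aemeasurable
      hf.continuous.aestronglyMeasurable]
    refine tendsto_nhds_unique (hν _ (hf.continuous.comp continuous_snd) ⟨M, fun z => hM z.2⟩) ?_
    simp only [hr2]
    exact (((short_integral hf).continuous.tendsto q).comp hql).mono_left hU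
  · set k : X × X → ℝ := fun z => min 1 (orderCost z.1 z.2) with hk
    have hkc : Continuous k := continuous_const.min continuous_orderCost
    have hk0 : ∀ z, 0 ≤ k z := fun z => le_min zero_le_one (orderCost_nonneg _ _)
    have hkb : ∀ z, |k z| ≤ 1 := fun z => by
      rw [abs_of_nonneg (hk0 z)]; exact min_le_left _ _
    have hki : ∀ (ρ : Measure (X × X)) [IsProbabilityMeasure ρ], Integrable k ρ := fun ρ _ =>
      Integrable.of_bound hkc.aestronglyMeasurable 1 (Eventually.of_forall hkb)
    have hint : ∫ z, k z ∂ν ≤ 0 := by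
      have hz : Tendsto (fun n : ℕ => 2 * (1 / ((n : ℝ) + 1))) (hyperfilter ℕ) (𝓝 0) := by
        simpa using (hlim0.const_mul 2).mono_left hU
      refine le_of_tendsto_of_tendsto' (hν k hkc ⟨1, hkb⟩) hz fun n => ?_
      refine (integral_mono (hki _) ?_ fun z => min_le_right _ _).trans (hrc n)
      -- the order cost is dominated by the distance, which is integrable for both marginals
      obtain ⟨x₀⟩ := p.nonempty
      have hd : LipschitzWith 1 fun z : X × X => dist z (x₀, x₀) := LipschitzWith.dist_left _
      refine (((r n).integrable_of_short hd).const_mul 2).mono'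
        continuous_orderCost.aestronglyMeasurable (Eventually.of_forall fun z => ?_)
      rw [Real.norm_of_nonneg (orderCost_nonneg _ _)]
      have h1 : dist z.1 x₀ ≤ dist z (x₀, x₀) := le_max_left _ _
      have h2 : dist z.2 x₀ ≤ dist z (x₀, x₀) := le_max_right _ _
      linarith [orderCost_le_dist z.1 z.2, dist_triangle_right z.1 z.2 x₀]
    have hzero := (integral_eq_zero_iff_of_nonneg hk0 (hki ν)).1
      (le_antisymm hint (integral_nonneg hk0))
    change ∀ᵐ z ∂ν, z.1 ≤ z.2
    filter_upwards [hzero] with z hkz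
    refine hL.le_of_orderCost_le_zero ?_
    have hkz' : min 1 (orderCost z.1 z.2) = 0 := hkz
    rcases min_choice 1 (orderCost z.1 z.2) with h' | h'
    · rw [h'] at hkz'; exact absurd hkz' one_ne_zero
    · exact (h'.symm.trans hkz').le

/-- A coupling supported on the graph of the order yields inequalities of integrals. -/
theorem integral_le_of_coupling [MeasurableSpace (X × X)] [BorelSpace (X × X)]
    {p q : KantorovichSpace X} {r : Measure (X × X)} (h1 : r.map Prod.fst = p.measure)
    (h2 : r.map Prod.snd = q.measure) (h : r {z | ¬ z.1 ≤ z.2} = 0) {f : X → ℝ}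
    (hf : LipschitzWith 1 f) (hm : Monotone f) :
    ∫ x, f x ∂p.measure ≤ ∫ x, f x ∂q.measure := by
  have hf1 := p.integrable_of_short hf
  have hf2 := q.integrable_of_short hf
  rw [← h1] at hf1 ⊢
  rw [← h2] at hf2 ⊢
  rw [MeasureTheory.integral_map continuous_fst.measurable.aemeasurable
      hf.continuous.aestronglyMeasurable, MeasureTheory.integral_map
      continuous_snd.measurable.aemeasurable hf.continuous.aestronglyMeasurable]
  refine integral_mono_ae (hf1.comp_measurable continuous_fst.measurable)
    (hf2.comp_measurable continuous_snd.measurable) ?_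
  have : ∀ᵐ z ∂r, z.1 ≤ z.2 := h
  filter_upwards [this] with z hz using hm hz

/-- Measures that integrate all short monotone functions equally are equal: a coupling supported on
the order is then supported on `{f x = f y}` for each short monotone `f`, and the complements of
these sets cover the strict order. -/
theorem eq_of_forall_integral_eq [CompleteSpace X] (hL : IsLOrdered X)
    {p q : KantorovichSpace X}
    (h : ∀ f : X → ℝ, LipschitzWith 1 f → Monotone f →
      ∫ x, f x ∂p.measure = ∫ x, f x ∂q.measure) : p = q := by
  let _ : MeasurableSpace (X × X) := borel _
  have : BorelSpace (X × X) := ⟨rfl⟩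
  obtain ⟨r, hr, h1, h2, hle⟩ :=
    exists_coupling_of_forall_integral_le hL fun f hf hm => (h f hf hm).le
  have hle' : ∀ᵐ z ∂r, z.1 ≤ z.2 := hle
  have hae : ∀ f : X → ℝ, LipschitzWith 1 f → Monotone f → r {z | f z.1 ≠ f z.2} = 0 := by
    intro f hf hm
    have hf1 := p.integrable_of_short hf
    have hf2 := q.integrable_of_short hf
    have heq := h f hf hm
    rw [← h1] at hf1 heq
    rw [← h2] at hf2 heq
    rw [MeasureTheory.integral_map continuous_fst.measurable.aemeasurable
      hf.continuous.aestronglyMeasurable, MeasureTheory.integral_map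
      continuous_snd.measurable.aemeasurable hf.continuous.aestronglyMeasurable] at heq
    have i1 := hf1.comp_measurable continuous_fst.measurable
    have i2 := hf2.comp_measurable continuous_snd.measurable
    have h0 : ∫ z, ((f ∘ Prod.snd) z - (f ∘ Prod.fst) z) ∂r = 0 := by
      rw [integral_sub i2 i1]
      simp only [Function.comp_apply]
      linarith
    have := (integral_eq_zero_iff_of_nonneg_ae (by
      filter_upwards [hle'] with z hz using sub_nonneg.2 (hm hz)) (i2.sub i1)).1 h0
    change ∀ᵐ z ∂r, f z.1 = f z.2
    filter_upwards [this] with z hz'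
    exact (sub_eq_zero.1 hz').symm
  have hmeas : MeasurableSet {z : X × X | z.1 ≤ z.2 ∧ z.1 ≠ z.2} := by
    have e : {z : X × X | z.1 ≤ z.2} = {z | orderCost z.1 z.2 ≤ 0} := by
      ext z
      exact ⟨fun hz => (orderCost_eq_zero_of_le hz).le, hL.le_of_orderCost_le_zero⟩
    exact (e ▸ (isClosed_le continuous_orderCost continuous_const).measurableSet :
      MeasurableSet {z : X × X | z.1 ≤ z.2}).inter
      (isClosed_eq continuous_fst continuous_snd).measurableSet.compl
  have hnull : r {z : X × X | z.1 ≤ z.2 ∧ z.1 ≠ z.2} = 0 := by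
    by_contra hne
    obtain ⟨K, hK, hKc, hK0⟩ := hr.innerRegular hmeas 0 (pos_iff_ne_zero.2 hne)
    refine hK0.ne' (hKc.measure_zero_of_nhdsWithin fun z hz => ?_)
    have hnle : ¬ z.2 ≤ z.1 := fun h' => (hK hz).2 (le_antisymm (hK hz).1 h')
    rw [hL] at hnle
    push Not at hnle
    obtain ⟨f, hf, hm, hlt⟩ := hnle
    refine ⟨{w | f w.1 ≠ f w.2}, mem_nhdsWithin_of_mem_nhds (IsOpen.mem_nhds ?_ hlt.ne),
      hae f hf hm⟩
    exact isOpen_ne_fun (hf.continuous.comp continuous_fst) (hf.continuous.comp continuous_snd)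
  refine ext_measure ?_
  rw [← h1, ← h2]
  refine Measure.map_congr ?_
  have hne' : ∀ᵐ z ∂r, ¬ (z.1 ≤ z.2 ∧ z.1 ≠ z.2) := by
    rw [ae_iff]; simpa using hnull
  filter_upwards [hle', hne'] with z hz hz'
  by_contra hc
  exact hz' ⟨hz, hc⟩

end Duality

end StochasticOrder

section TheMonad

open Filter Topology

namespace KantorovichSpace

variable {X : Type u} [MetricSpace X] [MeasurableSpace X] [BorelSpace X]

/-! ### Averaging measures of measures -/

theorem continuous_integral {f : X → ℝ} {C : NNReal} (hf : LipschitzWith C f) :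
    Continuous fun p : KantorovichSpace X => ∫ x, f x ∂p.measure := by
  have hC : (0 : ℝ) < C + 1 := by positivity
  refine ((short_integral hf.short_inv_mul).continuous.const_mul ((C : ℝ) + 1)).congr fun p => ?_
  rw [integral_const_mul, mul_inv_cancel_left₀ hC.ne']

/-- The Borel structure of the Wasserstein metric makes `p ↦ p S` measurable for Borel sets `S`. -/
theorem measurable_measure : Measurable (measure : KantorovichSpace X → Measure X) := by
  refine Measurable.measure_of_isPiSystem_of_isProbabilityMeasure
    ((BorelSpace.measurable_eq (α := X)).trans borel_eq_generateFrom_isClosed)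
    isPiSystem_isClosed fun F hF => ?_
  have hpos : ∀ n : ℕ, 0 < 1 / ((n : ℝ) + 1) := fun n => by positivity
  refine ENNReal.measurable_of_tendsto (f := fun (n : ℕ) (p : KantorovichSpace X) =>
    ∫⁻ x, (thickenedIndicator (hpos n) F x : ENNReal) ∂p.measure) (fun n => ?_)
    (tendsto_pi_nhds.2 fun p => tendsto_lintegral_thickenedIndicator_of_isClosed p.measure hF hpos
      (tendsto_one_div_add_atTop_nhds_zero_nat (𝕜 := ℝ)))
  have hl : LipschitzWith _ fun x => (thickenedIndicator (hpos n) F x : ℝ) :=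
    lipschitzWith_thickenedIndicator (hpos n) F
  have he : (fun p : KantorovichSpace X =>
      ∫⁻ x, (thickenedIndicator (hpos n) F x : ENNReal) ∂p.measure) =
      fun p => ENNReal.ofReal (∫ x, (thickenedIndicator (hpos n) F x : ℝ) ∂p.measure) := by
    funext p
    rw [ofReal_integral_eq_lintegral_ofReal (p.integrable_of_lipschitz hl)
      (Eventually.of_forall fun x => NNReal.coe_nonneg _)]
    simp
  rw [he]
  exact (continuous_integral hl).measurable.ennreal_ofReal

/-- Integration against a mixture `ν S = ∫ κ z S dμ(z)` of measures. -/
theorem integral_of_mixture {Z : Type*} [TopologicalSpace Z] [MeasurableSpace Z] [BorelSpace Z]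
    {μ : Measure Z} {κ : Z → KantorovichSpace X} (hκ : Continuous κ) {ν : Measure X}
    (hν : ∀ S, MeasurableSet S → ν S = ∫⁻ z, (κ z).measure S ∂μ) {f : X → ℝ}
    (hf : Integrable f ν) : ∫ x, f x ∂ν = ∫ z, ∫ x, f x ∂(κ z).measure ∂μ := by
  have hm : Measurable fun z => (κ z).measure := measurable_measure.comp hκ.measurable
  have he : ν = μ.bind fun z => (κ z).measure := by
    ext S hS
    rw [hν S hS, Measure.bind_apply hS hm.aemeasurable]
  let η : ProbabilityTheory.Kernel Z X := ⟨fun z => (κ z).measure, hm⟩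
  have hc : ν = (η.comp (ProbabilityTheory.Kernel.const Unit μ)) () := by
    rw [ProbabilityTheory.Kernel.comp_apply, ProbabilityTheory.Kernel.const_apply]
    exact he
  rw [hc] at hf ⊢
  rw [ProbabilityTheory.Kernel.integral_comp hf, ProbabilityTheory.Kernel.const_apply]
  rfl

/-- A mixture of measures, `S ↦ ∫ p S dm(p)`. It is tight since compact sets of measures are
uniformly tight. -/
noncomputable def join [CompleteSpace X] (m : KantorovichSpace (KantorovichSpace X)) :
    KantorovichSpace X :=
  have hm : AEMeasurable (measure : KantorovichSpace X → Measure X) m.measure :=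
    measurable_measure.aemeasurable
  have : IsProbabilityMeasure (m.measure.bind measure) := ⟨by
    rw [Measure.bind_apply MeasurableSet.univ hm]
    simp⟩
  ofTight (m.measure.bind measure)
    (fun ε hε => by
      have hε2 : ε / 2 ≠ 0 := by simpa using hε
      obtain ⟨C, hC, hCm⟩ := m.exists_compact hε2
      obtain ⟨K, hK, hKC⟩ := exists_compact_of_totallyBounded hC.totallyBounded hε2
      refine ⟨K, hK, ?_⟩
      rw [Measure.bind_apply hK.measurableSet.compl hm]
      calc ∫⁻ p, p.measure Kᶜ ∂m.measure
          ≤ ∫⁻ p, (ε / 2 + Cᶜ.indicator 1 p) ∂m.measure := by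
            refine lintegral_mono fun p => ?_
            by_cases hp : p ∈ C
            · exact (hKC p hp).trans le_self_add
            · rw [Set.indicator_of_mem (by exact hp)]
              exact prob_le_one.trans le_add_self
        _ = ε / 2 + m.measure Cᶜ := by
            rw [lintegral_add_left measurable_const, lintegral_const, measure_univ, mul_one,
              lintegral_indicator_one hC.measurableSet.compl]
        _ ≤ ε / 2 + ε / 2 := by gcongr
        _ = ε := ENNReal.add_halves ε)
    (fun x₀ => by
      have hd : LipschitzWith 1 fun x => dist x x₀ := LipschitzWith.dist_left x₀
      refine ⟨hd.continuous.aestronglyMeasurable, ?_⟩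
      rw [hasFiniteIntegral_iff_ofReal (Eventually.of_forall fun x => dist_nonneg),
        Measure.lintegral_bind hm hd.continuous.measurable.ennreal_ofReal.aemeasurable]
      have hi := (hasFiniteIntegral_iff_ofReal (Eventually.of_forall fun p =>
        integral_nonneg fun x => dist_nonneg)).1 (m.integrable_of_short (short_integral hd)).2
      exact (lintegral_congr fun p => (ofReal_integral_eq_lintegral_ofReal
        (p.integrable_of_short hd) (Eventually.of_forall fun x => dist_nonneg)).symm).trans_lt hi)

theorem join_apply [CompleteSpace X] (m : KantorovichSpace (KantorovichSpace X)) {S : Set X}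
    (hS : MeasurableSet S) : (join m).measure S = ∫⁻ p, p.measure S ∂m.measure :=
  Measure.bind_apply hS measurable_measure.aemeasurable

theorem integral_join [CompleteSpace X] (m : KantorovichSpace (KantorovichSpace X)) {f : X → ℝ}
    (hf : LipschitzWith 1 f) :
    ∫ x, f x ∂(join m).measure = ∫ p, ∫ x, f x ∂p.measure ∂m.measure :=
  integral_of_mixture continuous_id (fun _ hS => join_apply m hS) ((join m).integrable_of_short hf)

theorem short_join [CompleteSpace X] :
    LipschitzWith 1 (join : KantorovichSpace (KantorovichSpace X) → KantorovichSpace X) :=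
  LipschitzWith.of_dist_le_mul fun m n => by
    rw [NNReal.coe_one, one_mul]
    refine dist_le_of_forall fun f hf => ?_
    rw [integral_join m hf, integral_join n hf]
    exact integral_sub_le_dist m n (short_integral hf)

theorem short_map {Y : Type u} [MetricSpace Y] [MeasurableSpace Y] [BorelSpace Y] {f : X → Y}
    (hf : LipschitzWith 1 f) : LipschitzWith 1 (map f hf) :=
  LipschitzWith.of_dist_le_mul fun p q => by
    rw [NNReal.coe_one, one_mul]
    refine dist_le_of_forall fun g hg => ?_
    rw [integral_map hf p hg.continuous, integral_map hf q hg.continuous]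
    exact integral_sub_le_dist p q (f := fun x => g (f x))
      (by simpa [Function.comp_def] using hg.comp hf)

theorem short_dirac : LipschitzWith 1 (dirac : X → KantorovichSpace X) :=
  LipschitzWith.of_dist_le_mul fun x y => by
    rw [NNReal.coe_one, one_mul]
    refine dist_le_of_forall fun g hg => ?_
    rw [integral_dirac, integral_dirac, dist_comm]
    exact hg.sub_le_dist y x

theorem map_dirac {Y : Type u} [MetricSpace Y] [MeasurableSpace Y] [BorelSpace Y] {f : X → Y}
    (hf : LipschitzWith 1 f) (x : X) : map f hf (dirac x) = dirac (f x) :=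
  ext_short fun g hg => by
    rw [integral_map hf _ hg.continuous, integral_dirac x fun y => g (f y), integral_dirac]

theorem join_dirac [CompleteSpace X] (p : KantorovichSpace X) : join (dirac p) = p :=
  ext_short fun g hg => by rw [integral_join _ hg, integral_dirac p fun q => ∫ x, g x ∂q.measure]

theorem join_map_dirac [CompleteSpace X] (p : KantorovichSpace X) :
    join (map dirac short_dirac p) = p :=
  ext_short fun g hg => by
    rw [integral_join _ hg, integral_map _ _ (short_integral hg).continuous]
    simp only [integral_dirac]

theorem join_map_join [CompleteSpace X]
    (m : KantorovichSpace (KantorovichSpace (KantorovichSpace X))) :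
    join (map join short_join m) = join (join m) :=
  ext_short fun g hg => by
    rw [integral_join _ hg, integral_join _ hg, integral_map _ _ (short_integral hg).continuous,
      integral_join m (short_integral hg)]
    simp only [integral_join _ hg]

theorem join_map_map {Y : Type u} [MetricSpace Y] [MeasurableSpace Y] [BorelSpace Y]
    [CompleteSpace X] [CompleteSpace Y] {f : X → Y} (hf : LipschitzWith 1 f)
    (m : KantorovichSpace (KantorovichSpace X)) :
    join (map _ (short_map hf) m) = map f hf (join m) :=
  ext_short fun g hg => by
    rw [integral_join _ hg, integral_map _ _ (short_integral hg).continuous,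
      integral_map _ _ hg.continuous,
      integral_join m (f := fun x => g (f x)) (by simpa [Function.comp_def] using hg.comp hf)]
    simp only [integral_map hf _ hg.continuous]

end KantorovichSpace

/-! ### The stochastic order -/

namespace LCOMet

open KantorovichSpace

variable {X : LCOMet.{u}}

/-- The stochastic order is detected by the integrals of short monotone functions. -/
theorem stochLE_iff (p q : KantorovichSpace X.carrier) :
    StochLE (X := X) p q ↔ ∀ f : X.carrier → ℝ, LipschitzWith 1 f → Monotone f →
      ∫ x, f x ∂p.measure ≤ ∫ x, f x ∂q.measure := by
  let _ : MeasurableSpace (X.carrier × X.carrier) := borel (X.carrier × X.carrier)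
  have : BorelSpace (X.carrier × X.carrier) := ⟨rfl⟩
  constructor
  · rintro ⟨r, -, h1, h2, h⟩ f hf hm
    exact integral_le_of_coupling h1 h2 h hf hm
  · exact fun h => exists_coupling_of_forall_integral_le X.isLOrdered h

/-- The stochastic order on the measures of finite first moment. -/
instance : PartialOrder (KantorovichSpace X.carrier) where
  le p q := StochLE (X := X) p q
  le_refl p := (stochLE_iff p p).2 fun _ _ _ => le_rfl
  le_trans p q r hpq hqr := (stochLE_iff p r).2 fun f hf hm =>
    ((stochLE_iff p q).1 hpq f hf hm).trans ((stochLE_iff q r).1 hqr f hf hm)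
  le_antisymm p q hpq hqp := eq_of_forall_integral_eq X.isLOrdered fun f hf hm =>
    le_antisymm ((stochLE_iff p q).1 hpq f hf hm) ((stochLE_iff q p).1 hqp f hf hm)

theorem kantorovich_le_iff {p q : KantorovichSpace X.carrier} :
    p ≤ q ↔ ∀ f : X.carrier → ℝ, LipschitzWith 1 f → Monotone f →
      ∫ x, f x ∂p.measure ≤ ∫ x, f x ∂q.measure := stochLE_iff p q

theorem monotone_integral {f : X.carrier → ℝ} (hf : LipschitzWith 1 f) (hm : Monotone f) :
    Monotone fun p : KantorovichSpace X.carrier => ∫ x, f x ∂p.measure :=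
  fun _ _ h => kantorovich_le_iff.1 h f hf hm

variable (X) in
/-- The complete L-ordered metric space `PX`. -/
noncomputable def kantorovichObj : LCOMet.{u} where
  carrier := KantorovichSpace X.carrier
  isClosed_le := by
    have : {z : KantorovichSpace X.carrier × KantorovichSpace X.carrier | z.1 ≤ z.2} =
        ⋂ (f : X.carrier → ℝ) (_ : LipschitzWith 1 f) (_ : Monotone f),
          {z | ∫ x, f x ∂z.1.measure ≤ ∫ x, f x ∂z.2.measure} := by
      ext z
      simp only [Set.mem_iInter]
      exact kantorovich_le_iff
    rw [this]
    exact isClosed_iInter fun f => isClosed_iInter fun hf => isClosed_iInter fun _ =>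
      _root_.isClosed_le ((short_integral hf).continuous.comp continuous_fst)
        ((short_integral hf).continuous.comp continuous_snd)
  isLOrdered p q := ⟨fun h _ _ hm => hm h, fun h => kantorovich_le_iff.2 fun f hf hm =>
    h _ (short_integral hf) (monotone_integral hf hm)⟩

/-- The endofunctor `P`. -/
noncomputable def kantorovichFunctor : LCOMet.{u} ⥤ LCOMet.{u} where
  obj := kantorovichObj
  map {X Y} f :=
    { toFun := KantorovichSpace.map f.toFun f.short
      short := short_map f.short
      monotone := fun p q h => kantorovich_le_iff.2 fun g hg hm => by
        rw [integral_map f.short p hg.continuous, integral_map f.short q hg.continuous]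
        exact kantorovich_le_iff.1 h _ (by simpa [Function.comp_def] using hg.comp f.short)
          (hm.comp f.monotone) }
  map_id X := Hom.ext (funext fun p => ext_measure Measure.map_id)
  map_comp f g := Hom.ext (funext fun p => ext_measure
    (Measure.map_map g.short.continuous.measurable f.short.continuous.measurable).symm)

theorem monotone_dirac : Monotone (dirac : X.carrier → KantorovichSpace X.carrier) :=
  fun x y h => kantorovich_le_iff.2 fun g _ hm => by
    rw [KantorovichSpace.integral_dirac, KantorovichSpace.integral_dirac]
    exact hm h

theorem join_mono {m n : KantorovichSpace (kantorovichObj X).carrier} (h : m ≤ n) :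
    join (X := X.carrier) m ≤ join (X := X.carrier) n :=
  kantorovich_le_iff.2 fun g hg hm => by
    rw [integral_join (X := X.carrier) m hg, integral_join (X := X.carrier) n hg]
    exact (kantorovich_le_iff (X := kantorovichObj X)).1 h _ (short_integral hg)
      (monotone_integral hg hm)

/-- The ordered Kantorovich monad. -/
noncomputable def kantorovichMonad : Monad LCOMet.{u} where
  toFunctor := kantorovichFunctor
  η :=
    { app := fun X => ⟨fun x => (dirac x : KantorovichSpace X.carrier), short_dirac,
        monotone_dirac⟩
      naturality := fun _ _ f => Hom.ext (funext fun x => (map_dirac f.short x).symm) }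
  μ :=
    { app := fun X => ⟨fun m => (join m : KantorovichSpace X.carrier), short_join,
        fun _ _ h => join_mono h⟩
      naturality := fun _ _ f => Hom.ext (funext fun m => join_map_map f.short m) }
  assoc X := Hom.ext (funext fun m => join_map_join (X := X.carrier) m)
  left_unit X := Hom.ext (funext fun p => join_dirac (X := X.carrier) p)
  right_unit X := Hom.ext (funext fun p => join_map_dirac (X := X.carrier) p)

end LCOMet

/-- The ordered Kantorovich monad with its description by measures. -/
noncomputable def orderedKantorovichMonad : OrderedKantorovichMonad.{u} where
  monad := LCOMet.kantorovichMonad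
  law X := Equiv.refl (KantorovichSpace X.carrier)
  dist_law X p q := KantorovichSpace.isLUB_dist (X := X.carrier) p q
  le_iff _ _ _ := Iff.rfl
  law_map _ _ := rfl
  law_unit _ _ := rfl
  law_mul X m _ hS := KantorovichSpace.join_apply (X := X.carrier) m hS

end TheMonad

section Barycentres

open Filter Topology

namespace KantorovichSpace

variable {X : Type u} [MetricSpace X] [MeasurableSpace X] [BorelSpace X]

/-! ### Bochner integrals of short maps -/

/-- Short maps into normed spaces are Bochner integrable, as a Radon measure is concentrated on a
separable set. -/
theorem integrable_of_short_vector {E : Type*} [NormedAddCommGroup E] (p : KantorovichSpace X)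
    {f : X → E} (hf : LipschitzWith 1 f) : Integrable f p.measure := by
  have hm : AEStronglyMeasurable f p.measure := by
    let _ : MeasurableSpace E := borel E
    have : BorelSpace E := ⟨rfl⟩
    obtain ⟨S, hS, hSp⟩ := p.exists_isSeparable
    exact aestronglyMeasurable_iff_aemeasurable_separable.2
      ⟨hf.continuous.measurable.aemeasurable, f '' S, hS.image hf.continuous,
        hSp.mono fun x hx => ⟨x, hx, rfl⟩⟩
  obtain ⟨x₀⟩ := p.nonempty
  refine ((p.integrable_dist x₀).add (integrable_const ‖f x₀‖)).mono' hm
    (Eventually.of_forall fun x => ?_)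
  have h1 := hf.dist_le_mul x x₀
  rw [NNReal.coe_one, one_mul, dist_eq_norm] at h1
  have h2 := norm_add_le (f x - f x₀) (f x₀)
  rw [sub_add_cancel] at h2
  simp only [Pi.add_apply]
  linarith

theorem map_mix {Y : Type u} [MetricSpace Y] [MeasurableSpace Y] [BorelSpace Y] {f : X → Y}
    (hf : LipschitzWith 1 f) (t : unitInterval) (p q : KantorovichSpace X) :
    map f hf (mix t p q) = mix t (map f hf p) (map f hf q) :=
  ext_short fun g hg => by
    rw [integral_map _ _ hg.continuous, integral_mix t _ _ hg, integral_map _ _ hg.continuous,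
      integral_map _ _ hg.continuous]
    exact integral_mix t p q (by simpa [Function.comp_def] using hg.comp hf)

end KantorovichSpace

namespace OrderedKantorovichMonad

open KantorovichSpace

variable (P : OrderedKantorovichMonad.{u}) {X Y : LCOMet.{u}}

/-! ### Computing with an ordered Kantorovich monad -/

/-- The measure represented by a point of `P X`. -/
def toMeas (p : (P.monad.obj X).carrier) : KantorovichSpace X.carrier := P.law X p

/-- The point of `P X` that represents a measure. -/
def ofMeas (p : KantorovichSpace X.carrier) : (P.monad.obj X).carrier := (P.law X).symm p

@[simp]
theorem toMeas_ofMeas (p : KantorovichSpace X.carrier) : P.toMeas (P.ofMeas p) = p :=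
  (P.law X).apply_symm_apply p

@[simp]
theorem ofMeas_toMeas (p : (P.monad.obj X).carrier) : P.ofMeas (P.toMeas p) = p :=
  (P.law X).symm_apply_apply p

theorem dist_toMeas (p q : (P.monad.obj X).carrier) :
    dist (P.toMeas p) (P.toMeas q) = dist p q :=
  (isLUB_dist (P.toMeas p) (P.toMeas q)).unique (P.dist_law X p q)

theorem isometry_toMeas : Isometry (P.toMeas : (P.monad.obj X).carrier → _) :=
  Isometry.of_dist_eq P.dist_toMeas

theorem toMeas_le_iff {p q : (P.monad.obj X).carrier} :
    P.toMeas p ≤ P.toMeas q ↔ p ≤ q := (P.le_iff X p q).symm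

theorem toMeas_map (f : X ⟶ Y) (p : (P.monad.obj X).carrier) :
    P.toMeas ((P.monad.map f).toFun p) = KantorovichSpace.map f.toFun f.short (P.toMeas p) :=
  ext_measure (P.law_map f p)

theorem toMeas_unit (x : X.carrier) : P.toMeas ((P.monad.η.app X).toFun x) = dirac x :=
  ext_measure (P.law_unit X x)

theorem integral_mul (m : (P.monad.obj (P.monad.obj X)).carrier) {f : X.carrier → ℝ} {C : NNReal}
    (hf : LipschitzWith C f) :
    ∫ x, f x ∂(P.toMeas ((P.monad.μ.app X).toFun m)).measure =
      ∫ p, ∫ x, f x ∂(P.toMeas p).measure ∂(P.toMeas m).measure :=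
  integral_of_mixture P.isometry_toMeas.continuous (fun S hS => P.law_mul X m S hS)
    (integrable_of_lipschitz _ hf)

end OrderedKantorovichMonad

namespace ClosedConvexSubset

open KantorovichSpace

variable (K : ClosedConvexSubset.{u})

/-! ### Barycentres in closed convex subsets -/

theorem isometry_incl : Isometry K.incl := isometry_subtype_coe

theorem short_incl : LipschitzWith 1 K.incl := K.isometry_incl.lipschitz

theorem lipschitz_dual (g : K.B →L[ℝ] ℝ) : LipschitzWith ‖g‖₊ fun x => g (K.incl x) := by
  simpa [Function.comp_def] using g.lipschitz.comp K.short_incl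

/-- The barycentre `∫ x dp(x)`, a point of the closed convex set. -/
noncomputable def bary (p : KantorovichSpace (toLCOMet.obj K).carrier) :
    (toLCOMet.obj K).carrier :=
  (⟨∫ x, K.incl x ∂p.measure, K.convex.integral_mem K.isClosed
    (Eventually.of_forall fun x => Subtype.prop x) (p.integrable_of_short_vector K.short_incl)⟩ :
    K.A)

theorem incl_bary (p : KantorovichSpace (toLCOMet.obj K).carrier) :
    K.incl (K.bary p) = ∫ x, K.incl x ∂p.measure := rfl

theorem dual_bary (g : K.B →L[ℝ] ℝ) (p : KantorovichSpace (toLCOMet.obj K).carrier) :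
    g (K.incl (K.bary p)) = ∫ x, g (K.incl x) ∂p.measure :=
  (g.integral_comp_comm (p.integrable_of_short_vector K.short_incl)).symm

theorem ext_dual {x y : (toLCOMet.obj K).carrier}
    (h : ∀ g : K.B →L[ℝ] ℝ, g (K.incl x) = g (K.incl y)) : x = y :=
  K.isometry_incl.injective ((SeparatingDual.eq_iff_forall_dual_eq (R := ℝ)).2 h)

theorem bary_dirac (x : (toLCOMet.obj K).carrier) : K.bary (dirac x) = x :=
  K.ext_dual fun g => by rw [dual_bary, KantorovichSpace.integral_dirac x fun y => g (K.incl y)]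

theorem short_bary : LipschitzWith 1 K.bary :=
  LipschitzWith.of_dist_le_mul fun p q => by
    rw [NNReal.coe_one, one_mul, ← K.isometry_incl.dist_eq, dist_comm, dist_eq_norm]
    obtain ⟨g, hg, hgx⟩ := exists_dual_vector'' ℝ (K.incl (K.bary q) - K.incl (K.bary p))
    have hs : LipschitzWith 1 fun x => g (K.incl x) :=
      (K.lipschitz_dual g).weaken (by exact_mod_cast hg)
    have := integral_sub_le_dist p q hs
    rw [map_sub, dual_bary, dual_bary] at hgx
    simpa [hgx] using this

theorem monotone_bary : Monotone K.bary := by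
  intro p q hpq
  by_contra hn
  obtain ⟨g, hg0, hg⟩ := ProperCone.hyperplane_separation_point K.cone
    (x₀ := K.incl (K.bary q) - K.incl (K.bary p)) hn
  have := LCOMet.kantorovich_le_iff.1 hpq _ (K.lipschitz_dual g).short_inv_mul fun a b hab => by
    have := hg0 (K.incl b - K.incl a) hab
    rw [map_sub] at this
    exact mul_le_mul_of_nonneg_left (by linarith) (by positivity)
  rw [integral_const_mul, integral_const_mul, ← dual_bary, ← dual_bary] at this
  have h2 := le_of_mul_le_mul_left this (by positivity)
  rw [map_sub] at hg
  linarith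

theorem incl_bary_mix (t : unitInterval) (p q : KantorovichSpace (toLCOMet.obj K).carrier) :
    K.incl (K.bary (mix t p q)) =
      (t : ℝ) • K.incl (K.bary p) + (1 - t : ℝ) • K.incl (K.bary q) := by
  have hp := p.integrable_of_short_vector K.short_incl
  have hq := q.integrable_of_short_vector K.short_incl
  rw [incl_bary, measure_mix, integral_add_measure (hp.smul_measure (by simp))
    (hq.smul_measure (by simp)), integral_smul_measure, integral_smul_measure,
    ENNReal.toReal_ofReal t.2.1, ENNReal.toReal_ofReal (sub_nonneg.2 t.2.2)]
  rfl

variable {K} in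
/-- Short affine maps preserve barycentres: the graph of such a map is closed and convex, so it
contains the barycentre of the image of the measure on the graph. -/
theorem map_bary {L : ClosedConvexSubset.{u}} (f : K ⟶ L)
    (p : KantorovichSpace (toLCOMet.obj K).carrier) :
    L.bary (KantorovichSpace.map (toLCOMet.map f).toFun (toLCOMet.map f).short p) =
      f.toFun (K.bary p) := by
  set φ : K.A → K.B × L.B := fun x => ((x : K.B), (f.toFun x : L.B)) with hφ
  have hiso : Isometry φ := Isometry.of_dist_eq fun x y => by
    rw [Prod.dist_eq, Subtype.dist_eq]
    refine max_eq_left ?_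
    simpa [Subtype.dist_eq] using f.short.dist_le_mul x y
  have hcl : IsClosed (Set.range φ) := by
    have : CompleteSpace K.A := K.isClosed.completeSpace_coe
    exact hiso.isClosedEmbedding.isClosed_range
  have hconv : Convex ℝ (Set.range φ) := by
    rintro _ ⟨x, rfl⟩ _ ⟨y, rfl⟩ a b ha hb hab
    refine ⟨⟨a • (x : K.B) + b • (y : K.B), K.convex x.2 y.2 ha hb hab⟩, ?_⟩
    simp only [hφ, Prod.smul_mk, Prod.mk_add_mk, f.affine x y a b ha hb hab]
  have h1 : Integrable K.incl p.measure := p.integrable_of_short_vector K.short_incl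
  have hs : LipschitzWith 1 fun x : (toLCOMet.obj K).carrier => L.incl (f.toFun x) := by
    simpa [Function.comp_def] using! L.short_incl.comp (toLCOMet.map f).short
  have h2 := p.integrable_of_short_vector hs
  obtain ⟨x, hx⟩ := hconv.integral_mem hcl (μ := p.measure)
    (f := fun x : (toLCOMet.obj K).carrier => (K.incl x, L.incl (f.toFun x)))
    (Eventually.of_forall fun x => ⟨x, rfl⟩) (h1.prodMk h2)
  rw [integral_pair h1 h2] at hx
  have hx1 : x = K.bary p := Subtype.ext (congrArg Prod.fst hx)
  have hx2 : (f.toFun x : L.B) = ∫ x, L.incl (f.toFun x) ∂p.measure := congrArg Prod.snd hx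
  refine L.ext_dual fun g => ?_
  refine (L.dual_bary g _).trans ?_
  rw [KantorovichSpace.integral_map _ _ (L.lipschitz_dual g).continuous]
  refine (g.integral_comp_comm h2).trans ?_
  rw [← hx2, hx1]
  rfl

variable {K} in
/-- Short maps that preserve barycentres are affine: consider the two-point measures. -/
theorem affine_of_map_bary {L : ClosedConvexSubset.{u}} (h : toLCOMet.obj K ⟶ toLCOMet.obj L)
    (hh : ∀ m, L.bary (KantorovichSpace.map h.toFun h.short m) = h.toFun (K.bary m))
    (x y : K.A) (a b : ℝ) (ha : 0 ≤ a) (hb : 0 ≤ b) (hab : a + b = 1) :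
    L.incl (h.toFun (⟨a • (x : K.B) + b • (y : K.B), K.convex x.2 y.2 ha hb hab⟩ : K.A)) =
      a • L.incl (h.toFun x) + b • L.incl (h.toFun y) := by
  let t : unitInterval := ⟨a, ha, by linarith⟩
  have hb' : (1 - t : ℝ) = b := by change 1 - a = b; linarith
  let x' : (toLCOMet.obj K).carrier := x
  let y' : (toLCOMet.obj K).carrier := y
  have hm : K.bary (mix t (dirac x') (dirac y')) =
      (⟨a • (x : K.B) + b • (y : K.B), K.convex x.2 y.2 ha hb hab⟩ : K.A) := by
    refine K.isometry_incl.injective ?_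
    rw [incl_bary_mix, bary_dirac, bary_dirac, hb']
    rfl
  have key := hh (mix t (dirac x') (dirac y'))
  rw [map_mix, map_dirac, map_dirac, hm] at key
  have key' := congrArg L.incl key
  rw [incl_bary_mix, bary_dirac, bary_dirac, hb'] at key'
  exact key'.symm

/-! ### Closed convex subsets as algebras -/

variable (P : OrderedKantorovichMonad.{u})

/-- The algebra structure on a closed convex set given by integration. -/
noncomputable def toAlgebraObj : P.monad.Algebra where
  A := toLCOMet.obj K
  a :=
    { toFun := fun p => K.bary (P.toMeas p)
      short := by simpa [Function.comp_def] using K.short_bary.comp P.isometry_toMeas.lipschitz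
      monotone := fun _ _ h => K.monotone_bary (P.toMeas_le_iff.2 h) }
  unit := LCOMet.Hom.ext (funext fun x =>
    (congrArg K.bary (P.toMeas_unit x)).trans (K.bary_dirac x))
  assoc := LCOMet.Hom.ext (funext fun m => K.ext_dual fun g => by
    refine (K.dual_bary g _).trans (Eq.trans ?_ (K.dual_bary g _).symm)
    refine (P.integral_mul m (K.lipschitz_dual g)).trans ?_
    rw [P.toMeas_map]
    refine Eq.trans ?_ (KantorovichSpace.integral_map _ _ (K.lipschitz_dual g).continuous).symm
    exact integral_congr_ae (Eventually.of_forall fun p => (K.dual_bary g _).symm))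

/-- The functor sending a closed convex set to the algebra given by integration. -/
noncomputable def toAlgebra : ClosedConvexSubset.{u} ⥤ P.monad.Algebra where
  obj K := K.toAlgebraObj P
  map {K L} f :=
    { f := toLCOMet.map f
      h := LCOMet.Hom.ext (funext fun p =>
        (congrArg L.bary (P.toMeas_map (toLCOMet.map f) p)).trans (map_bary f (P.toMeas p))) }

instance : (toAlgebra P).Faithful where
  map_injective h := Hom.ext (congrArg (fun k => LCOMet.Hom.toFun k.f) h)

instance : (toAlgebra P).Full where
  map_surjective {K L} h := by
    let φ : toLCOMet.obj K ⟶ toLCOMet.obj L := h.f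
    refine ⟨⟨φ.toFun, φ.short, φ.monotone, affine_of_map_bary φ fun m => ?_⟩, rfl⟩
    have key : L.bary (P.toMeas ((P.monad.map φ).toFun (P.ofMeas m))) =
        φ.toFun (K.bary (P.toMeas (P.ofMeas m))) :=
      congrFun (congrArg LCOMet.Hom.toFun h.h) (P.ofMeas m)
    rw [P.toMeas_map, P.toMeas_ofMeas] at key
    exact key

end ClosedConvexSubset

end Barycentres

section AffineFunctions

open Filter Topology

namespace KantorovichSpace

variable {X : Type u} [MetricSpace X] [MeasurableSpace X]

/-! ### Existence of affine functions -/

/-- `HasBound a R y v D` expresses that some signed measure `v + c (q - p)`, where `a p` and `a q`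
are related, has norm at most `D`; the norm is the supremum of the integrals of the short functions
that vanish at the base point `y`. -/
def HasBound (a : KantorovichSpace X → X) (R : X → X → Prop) (y : X) (v : X →₀ ℝ) (D : ℝ) : Prop :=
  ∃ (c : ℝ) (p q : KantorovichSpace X), 0 ≤ c ∧ R (a p) (a q) ∧
    ∀ f : X → ℝ, LipschitzWith 1 f → f y = 0 → Finsupp.linearCombination ℝ f v +
      c * ((∫ x, f x ∂q.measure) - ∫ x, f x ∂p.measure) ≤ D

variable {a : KantorovichSpace X → X} {R : X → X → Prop} {y : X}

theorem HasBound.nonneg {v : X →₀ ℝ} {D : ℝ} (h : HasBound a R y v D) : 0 ≤ D := by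
  obtain ⟨c, p, q, -, -, h⟩ := h
  have := h (fun _ => 0) ((LipschitzWith.const (0 : ℝ)).weaken zero_le_one) rfl
  simpa [Finsupp.linearCombination_apply, Finsupp.sum] using this

theorem HasBound.smul {v : X →₀ ℝ} {D c : ℝ} (h : HasBound a R y v D) (hc : 0 ≤ c) :
    HasBound a R y (c • v) (c * D) := by
  obtain ⟨l, p, q, hl, hpq, h⟩ := h
  refine ⟨c * l, p, q, mul_nonneg hc hl, hpq, fun f hf hy => ?_⟩
  have := mul_le_mul_of_nonneg_left (h f hf hy) hc
  rw [map_smul, smul_eq_mul]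
  linarith

variable [BorelSpace X]

/-- A reflexive relation on `X` is compatible with a map `a : PX → X` if it is preserved by convex
combinations of measures. For an algebra of the Kantorovich monad this holds for equality and for
the order. -/
structure IsMixing (a : KantorovichSpace X → X) (R : X → X → Prop) : Prop where
  refl : ∀ x, R x x
  mix : ∀ (t : unitInterval) (p q p' q' : KantorovichSpace X), R (a p) (a q) → R (a p') (a q') →
    R (a (mix t p p')) (a (mix t q q'))

theorem dist_mix_le (t : unitInterval) (p s : KantorovichSpace X) :
    dist (KantorovichSpace.mix t p s) s ≤ t * dist p s :=
  dist_le_of_forall fun f hf => by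
    rw [integral_mix t p s hf]
    have := mul_le_mul_of_nonneg_left (integral_sub_le_dist p s hf) t.2.1
    linarith

theorem IsMixing.hasBound (hR : IsMixing a R) (y : X) (v : X →₀ ℝ) :
    HasBound a R y v (v.sum fun x c => |c| * dist x y) := by
  refine ⟨0, dirac y, dirac y, le_rfl, hR.refl _, fun f hf hy => ?_⟩
  rw [zero_mul, add_zero, Finsupp.linearCombination_apply]
  refine Finset.sum_le_sum fun x _ => ?_
  have := hf.dist_le_mul x y
  rw [NNReal.coe_one, one_mul, Real.dist_eq, hy, sub_zero] at this
  calc v x • f x ≤ |v x • f x| := le_abs_self _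
    _ = |v x| * |f x| := abs_mul _ _
    _ ≤ |v x| * dist x y := mul_le_mul_of_nonneg_left this (abs_nonneg _)

theorem HasBound.add (hR : IsMixing a R) {v w : X →₀ ℝ} {D E : ℝ} (hv : HasBound a R y v D)
    (hw : HasBound a R y w E) : HasBound a R y (v + w) (D + E) := by
  obtain ⟨c, p, q, hc, hpq, hv⟩ := hv
  obtain ⟨c', p', q', hc', hpq', hw⟩ := hw
  rcases (add_nonneg hc hc').eq_or_lt with h0 | h0
  · have h1 : c = 0 := by linarith
    have h2 : c' = 0 := by linarith
    subst h1 h2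
    refine ⟨0, p, q, le_rfl, hpq, fun f hf hy => ?_⟩
    have := hv f hf hy
    have := hw f hf hy
    rw [map_add]
    linarith
  · refine ⟨c + c', KantorovichSpace.mix ⟨c / (c + c'), by positivity,
      (div_le_one h0).2 (by linarith)⟩ p p', KantorovichSpace.mix ⟨c / (c + c'), by positivity,
      (div_le_one h0).2 (by linarith)⟩ q q', h0.le, hR.mix _ _ _ _ _ hpq hpq', fun f hf hy => ?_⟩
    have h1 := hv f hf hy
    have h2 := hw f hf hy
    rw [map_add, integral_mix _ _ _ hf, integral_mix _ _ _ hf]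
    have h3 : ∀ A B : ℝ, (c + c') * (c / (c + c') * A + (1 - c / (c + c')) * B) =
        c * A + c' * B := fun A B => by field_simp; ring
    rw [mul_sub, h3, h3]
    linarith

/-- The key estimate: if `δ x - δ y + c (q - p)` has norm at most `D`, then `g x - g y ≤ D` for
every short `g` that is monotone for the relation. The points `a (v k)`, where `v k` is the
normalisation of `c p + (n - k) δ x + k δ y`, form a chain from almost `x` to almost `y`. Each
`a (v k)` is related to `a (w k)`, where `w k` has `q` in place of `p`, and `w k` is at distance at
most `D / (n + c)` from `v (k + 1)`. -/
theorem HasBound.sub_le (hR : IsMixing a R) (ha : LipschitzWith 1 a) (hδ : ∀ x, a (dirac x) = x)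
    {x : X} {D : ℝ} (h : HasBound a R y (Finsupp.single x 1 - Finsupp.single y 1) D) {g : X → ℝ}
    (hg : LipschitzWith 1 g) (hgR : ∀ u v, R u v → g u ≤ g v) : g x - g y ≤ D := by
  have hD := h.nonneg
  obtain ⟨c, p, q, hc, hpq, h⟩ := h
  have h' : ∀ f : X → ℝ, LipschitzWith 1 f →
      f x - f y + c * ((∫ z, f z ∂q.measure) - ∫ z, f z ∂p.measure) ≤ D := by
    intro f hf
    have := h (fun z => f z - f y) (LipschitzWith.of_dist_le_mul fun u v => by
      rw [dist_sub_right]; exact hf.dist_le_mul u v) (sub_self _)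
    rw [map_sub, Finsupp.linearCombination_single, Finsupp.linearCombination_single,
      integral_sub (q.integrable_of_short hf) (integrable_const _),
      integral_sub (p.integrable_of_short hf) (integrable_const _)] at this
    simpa using this
  have hga : ∀ P Q : KantorovichSpace X, g (a P) - g (a Q) ≤ dist P Q := fun P Q => by
    refine (hg.sub_le_dist _ _).trans ?_
    simpa using ha.dist_le_mul P Q
  have main : ∀ n : ℕ, 0 < n →
      g x - g y ≤ D + c / (n + c) * (dist p (dirac x) + dist p (dirac y)) := by
    intro n hn
    have hn' : (0 : ℝ) < n := by exact_mod_cast hn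
    have hnc : 0 < n + c := by positivity
    let t : unitInterval := ⟨c / (n + c), by positivity, (div_le_one hnc).2 (by linarith)⟩
    have ht : (t : ℝ) = c / (n + c) := rfl
    let σ : ℕ → unitInterval := fun k => Set.projIcc 0 1 zero_le_one ((k : ℝ) / n)
    have hσ : ∀ k ≤ n, (σ k : ℝ) = k / n := fun k hk => by
      have : (k : ℝ) / n ∈ Set.Icc (0 : ℝ) 1 :=
        ⟨by positivity, (div_le_one hn').2 (by exact_mod_cast hk)⟩
      simp only [σ, Set.projIcc_of_mem _ this]
    let s : ℕ → KantorovichSpace X := fun k => KantorovichSpace.mix (σ k) (dirac y) (dirac x)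
    have hs : ∀ k ≤ n, ∀ f : X → ℝ, LipschitzWith 1 f →
        ∫ z, f z ∂(s k).measure = k / n * f y + (1 - k / n) * f x := fun k hk f hf => by
      simp only [s]
      rw [integral_mix _ _ _ hf, integral_dirac, integral_dirac, hσ k hk]
    have hs0 : s 0 = dirac x := ext_short fun f hf => by
      rw [hs 0 (Nat.zero_le n) f hf, integral_dirac]; simp
    have hsn : s n = dirac y := ext_short fun f hf => by
      rw [hs n le_rfl f hf, integral_dirac, div_self hn'.ne']; ring
    let v : ℕ → KantorovichSpace X := fun k => KantorovichSpace.mix t p (s k)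
    let w : ℕ → KantorovichSpace X := fun k => KantorovichSpace.mix t q (s k)
    have hvw : ∀ k, g (a (v k)) ≤ g (a (w k)) := fun k =>
      hgR _ _ (hR.mix t p q (s k) (s k) hpq (hR.refl _))
    have hwv : ∀ k < n, dist (v (k + 1)) (w k) ≤ D / (n + c) := fun k hk =>
      dist_le_of_forall fun f hf => by
        simp only [v, w]
        rw [integral_mix t q (s k) hf, integral_mix t p (s (k + 1)) hf, hs k hk.le f hf,
          hs (k + 1) hk f hf, ht, le_div_iff₀ hnc]
        refine le_trans (le_of_eq ?_) (h' f hf)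
        push_cast
        field_simp
        ring
    have hchain : ∀ k ≤ n, g (a (v 0)) ≤ g (a (v k)) + k * (D / (n + c)) := by
      intro k
      induction k with
      | zero => intro _; simp
      | succ k ih =>
        intro hk
        have h1 := ih (Nat.le_of_succ_le hk)
        have h2 := hvw k
        have h3 := hga (w k) (v (k + 1))
        rw [dist_comm] at h3
        have h4 := hwv k hk
        push_cast
        linarith
    have h1 := hchain n le_rfl
    have h2 : n * (D / (n + c)) ≤ D := by
      rw [mul_div_assoc', div_le_iff₀ hnc]
      nlinarith [mul_nonneg hD hc]
    have h3 := hga (dirac x) (v 0)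
    have h4 := hga (v n) (dirac y)
    have h5 := dist_mix_le t p (s 0)
    have h6 := dist_mix_le t p (s n)
    rw [dist_comm] at h3
    simp only [v, hs0, hsn, ht, hδ] at h1 h3 h4 h5 h6
    linarith
  have hlim : Tendsto (fun n : ℕ => D + c / (n + c) * (dist p (dirac x) + dist p (dirac y))) atTop
      (𝓝 (D + 0 * (dist p (dirac x) + dist p (dirac y)))) := by
    refine tendsto_const_nhds.add (Tendsto.mul_const _ ?_)
    exact tendsto_const_nhds.div_atTop
      (tendsto_atTop_add_const_right _ _ tendsto_natCast_atTop_atTop)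
  rw [zero_mul, add_zero] at hlim
  exact ge_of_tendsto hlim (by filter_upwards [eventually_gt_atTop 0] with n hn using main n hn)

/-- **Existence of affine functions.** By the Hahn–Banach theorem, for the sublinear functional
`v ↦ inf {D | HasBound a R y v D}`, the supremum of `g x - g y` over short functions `g` monotone
for `R` is bounded by the value for a function that is moreover affine, in the sense that it
commutes with `a`. -/
theorem IsMixing.exists_affine (hR : IsMixing a R) (ha : LipschitzWith 1 a)
    (hδ : ∀ x, a (dirac x) = x) (x y : X) :
    ∃ f : X → ℝ, LipschitzWith 1 f ∧ (∀ u v, R u v → f u ≤ f v) ∧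
      (∀ p : KantorovichSpace X, f (a p) = ∫ z, f z ∂p.measure) ∧
      ∀ g : X → ℝ, LipschitzWith 1 g → (∀ u v, R u v → g u ≤ g v) → g x - g y ≤ f x - f y := by
  rcases eq_or_ne x y with rfl | hxy
  · exact ⟨fun _ => 0, (LipschitzWith.const (0 : ℝ)).weaken zero_le_one, fun _ _ _ => le_rfl,
      by simp, by simp⟩
  set N : (X →₀ ℝ) → ℝ := fun v => sInf {D | HasBound a R y v D} with hN
  have hbdd : ∀ v, BddBelow {D | HasBound a R y v D} := fun v => ⟨0, fun D h => h.nonneg⟩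
  have hne : ∀ v, {D | HasBound a R y v D}.Nonempty := fun v => ⟨_, hR.hasBound y v⟩
  have hNle : ∀ {v D}, HasBound a R y v D → N v ≤ D := fun {v D} h => csInf_le (hbdd v) h
  have hN0 : ∀ v, 0 ≤ N v := fun v => le_csInf (hne v) fun D h => h.nonneg
  have hNsmul_le : ∀ c : ℝ, 0 < c → ∀ v, N (c • v) ≤ c * N v := by
    intro c hc v
    rw [← div_le_iff₀' hc]
    refine le_csInf (hne v) fun D h => ?_
    rw [div_le_iff₀' hc]
    exact hNle (h.smul hc.le)
  have hNsmul : ∀ c : ℝ, 0 < c → ∀ v, N (c • v) = c * N v := by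
    intro c hc v
    refine le_antisymm (hNsmul_le c hc v) ?_
    have := hNsmul_le c⁻¹ (inv_pos.2 hc) (c • v)
    rwa [inv_smul_smul₀ hc.ne', ← div_eq_inv_mul, le_div_iff₀' hc] at this
  have hNadd : ∀ v w, N (v + w) ≤ N v + N w := by
    intro v w
    have h1 : ∀ D, HasBound a R y v D → N (v + w) - D ≤ N w := fun D hD =>
      le_csInf (hne w) fun E hE => by linarith [hNle (hD.add hR hE)]
    have h2 : N (v + w) - N w ≤ N v := le_csInf (hne v) fun D hD => by linarith [h1 D hD]
    linarith
  set v₀ : X →₀ ℝ := Finsupp.single x 1 - Finsupp.single y 1 with hv₀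
  have hv₀ne : v₀ ≠ 0 := fun h => by
    have := DFunLike.congr_fun h x
    simp [hv₀, hxy.symm] at this
  obtain ⟨φ, hφ, hφN⟩ := exists_extension_of_le_sublinear
    (LinearPMap.mkSpanSingleton (K := ℝ) (L := ℝ) (σ := RingHom.id ℝ) v₀ (N v₀) hv₀ne)
    N hNsmul hNadd (by
      rintro ⟨z, hz⟩
      obtain ⟨c, rfl⟩ := Submodule.mem_span_singleton.1 hz
      rw [LinearPMap.mkSpanSingleton'_apply]
      simp only [RingHom.id_apply, smul_eq_mul]
      rcases lt_or_ge 0 c with hc | hc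
      · rw [hNsmul c hc]
      · exact (mul_nonpos_of_nonpos_of_nonneg hc (hN0 _)).trans (hN0 _))
  have hφv₀ : φ v₀ = N v₀ := by
    have := hφ ⟨v₀, Submodule.mem_span_singleton_self v₀⟩
    rw [LinearPMap.mkSpanSingleton_apply] at this
    exact this
  have hφle : ∀ {v D}, HasBound a R y v D → φ v ≤ D := fun h => (hφN _).trans (hNle h)
  set f : X → ℝ := fun z => φ (Finsupp.single z 1) with hf
  have hfs : LipschitzWith 1 f := by
    refine LipschitzWith.of_le_add fun u v => ?_
    have : HasBound a R y (Finsupp.single u 1 - Finsupp.single v 1) (dist u v) := by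
      refine ⟨0, dirac y, dirac y, le_rfl, hR.refl _, fun k hk _ => ?_⟩
      rw [map_sub, Finsupp.linearCombination_single, Finsupp.linearCombination_single]
      simpa using hk.sub_le_dist u v
    have := hφle this
    rw [map_sub] at this
    linarith
  refine ⟨f, hfs, fun u v huv => ?_, fun p => ?_, fun g hg hgR => ?_⟩
  · have : HasBound a R y (Finsupp.single u 1 - Finsupp.single v 1) 0 := by
      refine ⟨1, dirac u, dirac v, zero_le_one, by rwa [hδ, hδ], fun k hk _ => ?_⟩
      rw [map_sub, Finsupp.linearCombination_single, Finsupp.linearCombination_single,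
        integral_dirac, integral_dirac]
      simp
    have := hφle this
    rw [map_sub] at this
    linarith
  · -- for finitely supported measures this is the bound `0`; these measures are dense
    have hfin : ∀ (s : Finset X) (w : X → ℝ) (hw : ∀ i ∈ s, 0 ≤ w i) (h1 : ∑ i ∈ s, w i = 1),
        f (a (finComb s w id hw h1)) = ∫ z, f z ∂(finComb s w id hw h1).measure := by
      intro s w hw h1
      set P := finComb s w id hw h1 with hP
      set V : X →₀ ℝ := ∑ i ∈ s, w i • Finsupp.single i (1 : ℝ) with hV
      have hlc : ∀ k : X → ℝ, Finsupp.linearCombination ℝ k V = ∫ z, k z ∂P.measure := by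
        intro k
        rw [hP, integral_finComb, hV, map_sum]
        refine Finset.sum_congr rfl fun i _ => ?_
        rw [map_smul, Finsupp.linearCombination_single]
        simp
      have hφV : φ V = ∫ z, f z ∂P.measure := by
        rw [hP, integral_finComb, hV, map_sum]
        refine Finset.sum_congr rfl fun i _ => ?_
        rw [map_smul]
        rfl
      have b1 : HasBound a R y (V - Finsupp.single (a P) 1) 0 := by
        refine ⟨1, P, dirac (a P), zero_le_one, by rw [hδ]; exact hR.refl _, fun k hk _ => ?_⟩
        rw [map_sub, Finsupp.linearCombination_single, integral_dirac, hlc]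
        simp
      have b2 : HasBound a R y (Finsupp.single (a P) 1 - V) 0 := by
        refine ⟨1, dirac (a P), P, zero_le_one, by rw [hδ]; exact hR.refl _, fun k hk _ => ?_⟩
        rw [map_sub, Finsupp.linearCombination_single, integral_dirac, hlc]
        simp
      have c1 := hφle b1
      have c2 := hφle b2
      rw [map_sub, hφV] at c1 c2
      exact le_antisymm (by linarith) (by linarith)
    refine eq_of_forall_dist_le fun ε hε => ?_
    obtain ⟨s, w, hw, h1, hd⟩ := p.exists_finComb_dist_lt (half_pos hε)
    have e1 := (hfs.comp ha).dist_le_mul p (finComb s w id hw h1)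
    have e2 := (short_integral hfs).dist_le_mul p (finComb s w id hw h1)
    simp only [Function.comp_apply, mul_one, NNReal.coe_one, one_mul] at e1 e2
    rw [hfin s w hw h1] at e1
    have := dist_triangle_right (f (a p)) (∫ z, f z ∂p.measure)
      (∫ z, f z ∂(finComb s w id hw h1).measure)
    linarith
  · have h1 : f x - f y = N v₀ := by rw [← hφv₀, hv₀, map_sub]
    rw [h1]
    exact le_csInf (hne _) fun D hD => hD.sub_le hR ha hδ hg hgR

end KantorovichSpace

end AffineFunctions

section Embedding

open Filter Topology

/-! ### Algebras are closed convex subsets -/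

namespace OrderedKantorovichMonad

open KantorovichSpace

variable {P : OrderedKantorovichMonad.{u}} (A : P.monad.Algebra)

/-- The structure map of an algebra, as a map on measures. -/
def act (p : KantorovichSpace A.A.carrier) : A.A.carrier := A.a.toFun (P.ofMeas p)

theorem isometry_ofMeas {X : LCOMet.{u}} :
    Isometry (P.ofMeas : KantorovichSpace X.carrier → (P.monad.obj X).carrier) :=
  Isometry.of_dist_eq fun p q => by rw [← P.dist_toMeas, P.toMeas_ofMeas, P.toMeas_ofMeas]

theorem short_act : LipschitzWith 1 (act A) := by
  simpa [Function.comp_def] using! A.a.short.comp (isometry_ofMeas (P := P)).lipschitz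

theorem act_mono {p q : KantorovichSpace A.A.carrier} (h : p ≤ q) : act A p ≤ act A q :=
  A.a.monotone (P.toMeas_le_iff.1 (by rwa [P.toMeas_ofMeas, P.toMeas_ofMeas]))

theorem act_dirac (x : A.A.carrier) : act A (dirac x) = x := by
  have h1 : P.ofMeas (dirac x) = (P.monad.η.app A.A).toFun x := by
    rw [← P.toMeas_unit, P.ofMeas_toMeas]
  rw [act, h1]
  exact congrFun (congrArg LCOMet.Hom.toFun A.unit) x

/-- The value of an algebra on a convex combination only depends on the values on the two parts. -/
theorem act_mix (t : unitInterval) (p q : KantorovichSpace A.A.carrier) :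
    act A (mix t p q) = act A (mix t (dirac (act A p)) (dirac (act A q))) := by
  let M : KantorovichSpace (P.monad.obj A.A).carrier :=
    mix t (dirac (P.ofMeas p)) (dirac (P.ofMeas q))
  have key : A.a.toFun ((P.monad.μ.app A.A).toFun (P.ofMeas M)) =
      A.a.toFun ((P.monad.map A.a).toFun (P.ofMeas M)) :=
    congrFun (congrArg LCOMet.Hom.toFun A.assoc) (P.ofMeas M)
  have h1 : P.toMeas ((P.monad.μ.app A.A).toFun (P.ofMeas M)) = mix t p q :=
    ext_short fun f hf => by
      have hs : LipschitzWith 1 fun p' : (P.monad.obj A.A).carrier =>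
          ∫ x, f x ∂(P.toMeas p').measure := by
        simpa [Function.comp_def] using (short_integral hf).comp P.isometry_toMeas.lipschitz
      rw [P.integral_mul _ hf, P.toMeas_ofMeas, integral_mix t _ _ hs, integral_mix t _ _ hf,
        KantorovichSpace.integral_dirac (P.ofMeas p) fun p' => ∫ x, f x ∂(P.toMeas p').measure,
        KantorovichSpace.integral_dirac (P.ofMeas q) fun p' => ∫ x, f x ∂(P.toMeas p').measure,
        P.toMeas_ofMeas, P.toMeas_ofMeas]
  have h2 : P.toMeas ((P.monad.map A.a).toFun (P.ofMeas M)) =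
      mix t (dirac (act A p)) (dirac (act A q)) := by
    rw [P.toMeas_map, P.toMeas_ofMeas, map_mix, map_dirac, map_dirac]
    rfl
  rw [act, ← h1, P.ofMeas_toMeas, key, act, ← h2, P.ofMeas_toMeas]

theorem isMixing_eq : IsMixing (act A) Eq where
  refl _ := rfl
  mix t p q p' q' h h' := by rw [act_mix, h, h', ← act_mix]

theorem isMixing_le : IsMixing (act A) (· ≤ ·) where
  refl _ := le_rfl
  mix t p q p' q' h h' := by
    rw [act_mix, act_mix A t q q']
    refine act_mono A (LCOMet.kantorovich_le_iff.2 fun f hf hm => ?_)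
    rw [integral_mix t _ _ hf, integral_mix t _ _ hf]
    simp only [KantorovichSpace.integral_dirac]
    exact add_le_add (mul_le_mul_of_nonneg_left (hm h) t.2.1)
      (mul_le_mul_of_nonneg_left (hm h') (sub_nonneg.2 t.2.2))

/-- The short functions on an algebra that are affine, that is, commute with the structure map. -/
structure AffineFun : Type u where
  toFun : A.A.carrier → ℝ
  short : LipschitzWith 1 toFun
  affine : ∀ p : KantorovichSpace A.A.carrier, toFun (act A p) = ∫ x, toFun x ∂p.measure

instance : TopologicalSpace (AffineFun A) := ⊥

instance : DiscreteTopology (AffineFun A) := ⟨rfl⟩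

variable {A}

/-- The value of a function at a base point (zero if the space is empty). -/
noncomputable def AffineFun.base (f : AffineFun A) : ℝ :=
  open Classical in if h : Nonempty A.A.carrier then f.toFun h.some else 0

theorem AffineFun.toFun_mix (f : AffineFun A) (t : unitInterval) (x y : A.A.carrier) :
    f.toFun (act A (mix t (dirac x) (dirac y))) = t * f.toFun x + (1 - t) * f.toFun y := by
  rw [f.affine, integral_mix _ _ _ f.short, KantorovichSpace.integral_dirac,
    KantorovichSpace.integral_dirac]

variable (A)

/-- The embedding of an algebra into the Banach space of bounded functions on the set of its short
affine functions. -/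
noncomputable def embed (x : A.A.carrier) : BoundedContinuousFunction (AffineFun A) ℝ :=
  .ofNormedAddCommGroupDiscrete (fun f => f.toFun x - f.base)
    (dist x (Nonempty.some (⟨x⟩ : Nonempty A.A.carrier))) fun f => by
      have h : Nonempty A.A.carrier := ⟨x⟩
      have := f.short.dist_le_mul x h.some
      rw [NNReal.coe_one, one_mul] at this
      rw [AffineFun.base, dif_pos h, ← dist_eq_norm]
      exact this

theorem embed_apply (x : A.A.carrier) (f : AffineFun A) : embed A x f = f.toFun x - f.base := rfl

theorem isometry_embed : Isometry (embed A) := by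
  refine Isometry.of_dist_eq fun x y => le_antisymm ?_ ?_
  · refine (BoundedContinuousFunction.dist_le dist_nonneg).2 fun f => ?_
    rw [embed_apply, embed_apply, dist_sub_right]
    simpa using f.short.dist_le_mul x y
  · obtain ⟨f, hf, -, hfa, h⟩ := (isMixing_eq A).exists_affine (short_act A) (act_dirac A) x y
    have h1 := h (fun z => dist z y) (LipschitzWith.dist_left y) fun u v huv => by rw [huv]
    rw [dist_self, sub_zero] at h1
    have h2 := BoundedContinuousFunction.dist_coe_le_dist (f := embed A x) (g := embed A y)
      (⟨f, hf, hfa⟩ : AffineFun A)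
    rw [embed_apply, embed_apply, dist_sub_right, Real.dist_eq] at h2
    exact h1.trans ((le_abs_self _).trans h2)

/-- The cone of the bounded functions that are nonnegative on monotone affine functions. -/
def affineCone : ProperCone ℝ (BoundedContinuousFunction (AffineFun A) ℝ) where
  carrier := {φ | ∀ f : AffineFun A, Monotone f.toFun → 0 ≤ φ f}
  add_mem' h h' f hf := add_nonneg (h f hf) (h' f hf)
  zero_mem' _ _ := le_rfl
  smul_mem' c _ h f hf := mul_nonneg c.2 (h f hf)
  isClosed' := by
    simp only [Set.ofPred_forall]
    exact isClosed_iInter fun f => isClosed_iInter fun _ =>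
      _root_.isClosed_le continuous_const (BoundedContinuousFunction.evalCLM ℝ f).continuous

theorem mem_affineCone {φ : BoundedContinuousFunction (AffineFun A) ℝ} :
    φ ∈ affineCone A ↔ ∀ f : AffineFun A, Monotone f.toFun → 0 ≤ φ f := Iff.rfl

theorem embed_sub_mem_iff {x y : A.A.carrier} :
    embed A y - embed A x ∈ affineCone A ↔ x ≤ y := by
  rw [mem_affineCone]
  constructor
  · intro h
    rw [A.A.isLOrdered]
    intro g hg hm
    obtain ⟨f, hf, hfm, hfa, hfg⟩ :=
      (isMixing_le A).exists_affine (short_act A) (act_dirac A) x y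
    have h1 := h ⟨f, hf, hfa⟩ fun u v huv => hfm u v huv
    have h2 := hfg g hg fun u v huv => hm huv
    rw [BoundedContinuousFunction.sub_apply, embed_apply, embed_apply] at h1
    simp only at h1
    linarith
  · intro h f hf
    rw [BoundedContinuousFunction.sub_apply, embed_apply, embed_apply]
    linarith [hf h]

/-- The closed convex subset of an ordered Banach space that is isomorphic to a given algebra. -/
noncomputable def toClosedConvexSubset : ClosedConvexSubset.{u} where
  B := BoundedContinuousFunction (AffineFun A) ℝ
  cone := affineCone A
  A := Set.range (embed A)
  isClosed := (isometry_embed A).isClosedEmbedding.isClosed_range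
  convex := by
    rintro _ ⟨x, rfl⟩ _ ⟨y, rfl⟩ a b ha hb hab
    have hb' : b = 1 - a := by linarith
    refine ⟨act A (mix ⟨a, ha, by linarith⟩ (dirac x) (dirac y)), ?_⟩
    ext f
    rw [embed_apply, f.toFun_mix]
    simp only [BoundedContinuousFunction.add_apply, BoundedContinuousFunction.smul_apply,
      embed_apply, smul_eq_mul, hb']
    ring
  antisymm := by
    rintro _ ⟨x, rfl⟩ _ ⟨y, rfl⟩ h h'
    rw [le_antisymm ((embed_sub_mem_iff A).1 h) ((embed_sub_mem_iff A).1 h')]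

/-- The isomorphism of ordered metric spaces from an algebra to the closed convex subset. -/
noncomputable def embedIso : A.A ≅ ClosedConvexSubset.toLCOMet.obj (toClosedConvexSubset A) where
  hom :=
    { toFun := fun x => (⟨embed A x, x, rfl⟩ : Set.range (embed A))
      short := LipschitzWith.of_dist_le_mul fun x y => by
        rw [NNReal.coe_one, one_mul]
        exact ((isometry_embed A).dist_eq x y).le
      monotone := fun _ _ h => (embed_sub_mem_iff A).2 h }
  inv :=
    { toFun := fun z : Set.range (embed A) => z.2.choose
      short := LipschitzWith.of_dist_le_mul fun (z w : Set.range (embed A)) => by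
        rw [NNReal.coe_one, one_mul, ← (isometry_embed A).dist_eq, z.2.choose_spec,
          w.2.choose_spec]
        exact le_rfl
      monotone := fun (z w : Set.range (embed A)) h => by
        rw [← embed_sub_mem_iff, z.2.choose_spec, w.2.choose_spec]
        exact h }
  hom_inv_id := LCOMet.Hom.ext (funext fun x => (isometry_embed A).injective
    (⟨embed A x, x, rfl⟩ : Set.range (embed A)).2.choose_spec)
  inv_hom_id := LCOMet.Hom.ext (funext fun (z : Set.range (embed A)) =>
    Subtype.ext z.2.choose_spec)

theorem bary_embed (p : KantorovichSpace A.A.carrier) :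
    (toClosedConvexSubset A).bary
        (KantorovichSpace.map (embedIso A).hom.toFun (embedIso A).hom.short p) =
      (embedIso A).hom.toFun (act A p) := by
  refine (toClosedConvexSubset A).isometry_incl.injective ?_
  refine BoundedContinuousFunction.ext fun f => ?_
  have h1 := (toClosedConvexSubset A).dual_bary (BoundedContinuousFunction.evalCLM ℝ f)
    (KantorovichSpace.map (embedIso A).hom.toFun (embedIso A).hom.short p)
  rw [KantorovichSpace.integral_map _ _
    ((toClosedConvexSubset A).lipschitz_dual (BoundedContinuousFunction.evalCLM ℝ f)).continuous]
    at h1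
  refine h1.trans ?_
  change ∫ x, (f.toFun x - f.base) ∂p.measure = f.toFun (act A p) - f.base
  rw [integral_sub (p.integrable_of_short f.short) (integrable_const _), f.affine]
  simp

/-- Every algebra is isomorphic to a closed convex subset with integration. -/
noncomputable def algebraIso :
    A ≅ (ClosedConvexSubset.toAlgebra P).obj (toClosedConvexSubset A) :=
  Monad.Algebra.isoMk (embedIso A) <| LCOMet.Hom.ext <| funext fun p => by
    have h := bary_embed A (P.toMeas p)
    rw [← P.toMeas_map, act, P.ofMeas_toMeas] at h
    exact h

end OrderedKantorovichMonad

instance (P : OrderedKantorovichMonad.{u}) : (ClosedConvexSubset.toAlgebra P).EssSurj where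
  mem_essImage A := ⟨_, ⟨(OrderedKantorovichMonad.algebraIso A).symm⟩⟩

instance (P : OrderedKantorovichMonad.{u}) :
    (ClosedConvexSubset.toAlgebra P).IsEquivalence where

end Embedding

theorem mainTheorem2 :
    Nonempty OrderedKantorovichMonad.{u} ∧
    ∀ P : OrderedKantorovichMonad.{u},
      ∃ (F : ClosedConvexSubset.{u} ≌ P.monad.Algebra)
        (i : F.functor ⋙ P.monad.forget ≅ ClosedConvexSubset.toLCOMet.{u}),
        ∀ (K : ClosedConvexSubset.{u}) (p : (P.monad.obj (F.functor.obj K).A).carrier),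
          K.incl ((i.hom.app K).toFun ((F.functor.obj K).a.toFun p)) =
            ∫ x, K.incl ((i.hom.app K).toFun x) ∂(P.law (F.functor.obj K).A p).measure := by
  -- the functor to algebras strictly commutes with the forgetful functors
  refine ⟨⟨orderedKantorovichMonad⟩, fun P => ⟨(ClosedConvexSubset.toAlgebra P).asEquivalence,
    Iso.refl ClosedConvexSubset.toLCOMet.{u}, fun _ _ => rfl⟩⟩
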